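/- Let $\mathcal A\subseteq \mathscr B(\mathcal H)$ be a von Neumann algebra on a complex Hilbert space and let $\tau:\mathcal A\to\mathcal A$ be a normal, contractive, completely positive map. For $\lambda\in\mathbb T$ (the unit circle) put $E_\lambda(\tau)=\{x\in\mathcal A:\tau(x)=\lambda x\}$, let $E(\tau)$ be the linear span of $\bigcup_{\lambda\in\mathbb T}E_\lambda(\tau)$, and let $\mathcal P(\tau)$ be the norm closure of $E(\tau)$. Then: (a) The limit $q_\tau:=\operatorname{s-lim}_{n\to\infty}\tau^n(1)$ exists in the strong operator topology. (b) There is exactly one norm-continuous bilinear map $\circ:\mathcal P(\tau)\times\mathcal P(\tau)\to\mathcal P(\tau)$ (the extended Choi–Effros product) such that $$x\circ y=\operatorname{s-lim}_{n\to\infty}\frac{\tau^n(xy)}{\lambda^n\mu^n}\qquad (x\in E_\lambda(\tau),\ y\in E_\mu(\tau),\ \lambda,\mu\in\mathbb T),$$ and $\mathcal P(\tau)$, with this product and with the involution and the norm of $\mathcal A$, is a (possibly zero, not necessarily unital) $C^*$-algebra, the peripheral Poisson boundary of $\tau$. Moreover, if $(\mathcal K,\mathcal B,\theta)$ is a minimal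 dilation of $\tau$, that is, $\mathcal H\subseteq\mathcal K$ are Hilbert spaces with orthogonal projection $p:\mathcal K\to\mathcal H$, $\mathcal B\subseteq\mathscr B(\mathcal K)$ is a von Neumann algebra with $\mathcal A=p\mathcal Bp$, $\theta$ is a normal $*$-endomorphism of $\mathcal B$ with $p\theta^n(z)p=\tau^n(pzp)$ for all $z\in\mathcal B$ and $n\ge 0$, $\mathcal K$ is the closed linear span of the vectors $\theta^n(x_n)\cdots\theta(x_1)h$ ($n\ge0$, $x_i\in\mathcal A$, $h\in\mathcal H$), and $\mathcal B$ is generated as a von Neumann algebra by $\{\theta^n(x):n\ge0,\ x\in\mathcal A\}$, then every $x\in\mathcal P(\tau)$ has a unique lift $\widehat x\in\mathcal P(\theta)$ with $p\widehat xp=x$, and $x\circ y=p\,\widehat x\,\widehat y\,p$ for all $x,y\in\mathcal P(\tau)$. (c) The following are equivalent: (i) $q_\tau\neq0$; (ii) $\tau$ has a nonzero fixed point; (iii) $\mathcal P(\tau)\neq\{0\}$; (iv) $(\mathcal P(\tau),\circ)$ is a unital $C^*$-algebra, with unit different from $0$. (d) If these conditions hold, then $q_\tau$ belongs to $\mathcal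 P(\tau)$ and is the unit of $(\mathcal P(\tau),\circ)$, and $q_\tau$ is the unique maximal Perron–Frobenius eigenvector of $\tau$. Here $x\in\mathcal A$ is a Perron–Frobenius eigenvector of $\tau$ if $x\ge0$, $\|x\|=1$ and $\tau(x)=rx$, where $r$ is the spectral radius of $\tau$; it is maximal if $y\le x$ for every Perron–Frobenius eigenvector $y$ of $\tau$. -/

import Mathlib

open Filter Topology
open scoped CStarAlgebra

/-! ### A (concrete) von Neumann algebra as a C*-algebra ordered by the Loewner order -/

namespace VonNeumannAlgebra

variable {H : Type*} [NormedAddCommGroup H] [InnerProductSpace ℂ H] [CompleteSpace H]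

instance instSMulMemClass : SMulMemClass (VonNeumannAlgebra H) ℂ (H →L[ℂ] H) where
  smul_mem {s} r _ hx := s.toStarSubalgebra.smul_mem hx r

instance instIsClosed (A : VonNeumannAlgebra H) : IsClosed (A : Set (H →L[ℂ] H)) := by
  rw [← A.centralizer_centralizer]
  exact Set.isClosed_centralizer _

noncomputable instance instCStarAlgebra (A : VonNeumannAlgebra H) : CStarAlgebra A :=
  StarSubalgebra.cstarAlgebra A

/-- The order on `A` is the restriction of the Loewner order of `B(H)`; its positive cone is
`{s* s : s ∈ A}`, because a von Neumann algebra contains the square roots of its positive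
elements. -/
instance instStarOrderedRing (A : VonNeumannAlgebra H) : StarOrderedRing A :=
  StarOrderedRing.of_nonneg_iff' (fun {x y} h z => by
      change (z : H →L[ℂ] H) + x ≤ z + y
      have h' : (x : H →L[ℂ] H) ≤ y := h
      gcongr)
    (fun x => by
      constructor
      · intro h
        have h' : (0 : H →L[ℂ] H) ≤ x := h
        have hmem : CFC.sqrt (x : H →L[ℂ] H) ∈ A := by
          have key : CFC.sqrt (x : H →L[ℂ] H) ∈ A.commutant.commutant := by
            rw [mem_commutant_iff]
            intro g hg
            have hc : Commute (x : H →L[ℂ] H) g := (mem_commutant_iff.mp hg) x x.2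
            exact (hc.cfcₙ_nnreal _).eq.symm
          rwa [commutant_commutant] at key
        refine ⟨⟨CFC.sqrt (x : H →L[ℂ] H), hmem⟩, Subtype.ext ?_⟩
        change (x : H →L[ℂ] H) = star (CFC.sqrt (x : H →L[ℂ] H)) * CFC.sqrt (x : H →L[ℂ] H)
        rw [(CFC.sqrt_nonneg (x : H →L[ℂ] H)).isSelfAdjoint.star_eq,
          CFC.sqrt_mul_sqrt_self _ h']
      · rintro ⟨s, rfl⟩
        change (0 : H →L[ℂ] H) ≤ star (s : H →L[ℂ] H) * s
        exact star_mul_self_nonneg _)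

end VonNeumannAlgebra

namespace PeripheralPoisson

variable {H : Type*} [NormedAddCommGroup H] [InnerProductSpace ℂ H] [CompleteSpace H]

/-- Convergence of a sequence in `A ⊆ B(H)` in the strong operator topology of `B(H)`. -/
def SOTTendsto {A : VonNeumannAlgebra H} (a : ℕ → A) (b : A) : Prop :=
  ∀ h : H, Tendsto (fun n => (a n : H →L[ℂ] H) h) atTop (𝓝 ((b : H →L[ℂ] H) h))

/-- The eigenspace `E_λ(T) = {x ∈ A : T x = λ x}`. -/
noncomputable def eigenspace {A : VonNeumannAlgebra H} (T : A →ₗ[ℂ] A) (lam : Circle) : Submodule ℂ A :=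
  Module.End.eigenspace T (lam : ℂ)

/-- `E(T)`: the linear span of all peripheral eigenvectors of `T`. -/
noncomputable def peripheralSpan {A : VonNeumannAlgebra H} (T : A →ₗ[ℂ] A) : Submodule ℂ A :=
  Submodule.span ℂ {x : A | ∃ lam : Circle, x ∈ eigenspace T lam}

/-- `P(T)`: the norm closure of `E(T)`. -/
noncomputable def boundary {A : VonNeumannAlgebra H} (T : A →ₗ[ℂ] A) : Submodule ℂ A :=
  (peripheralSpan T).topologicalClosure

theorem mem_boundary_of_mem_eigenspace {A : VonNeumannAlgebra H} {T : A →ₗ[ℂ] A}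
    {lam : Circle} {x : A} (hx : x ∈ eigenspace T lam) : x ∈ boundary T :=
  (peripheralSpan T).le_topologicalClosure (Submodule.subset_span ⟨lam, hx⟩)

/-- `m` is the extended Choi–Effros product `∘` on `P(τ)`: it is a norm continuous bilinear map
with `x ∘ y = s-lim τⁿ(x y) / (λⁿ μⁿ)` for `x ∈ E_λ(τ)`, `y ∈ E_μ(τ)`, `|λ| = |μ| = 1`.
Since `P(τ)` is the closed linear span of the `E_λ(τ)`, there is at most one such `m`. -/
def IsChoiEffrosProduct {A : VonNeumannAlgebra H} (T : A →ₗ[ℂ] A)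
    (m : boundary T →L[ℂ] boundary T →L[ℂ] boundary T) : Prop :=
  ∀ (lam mu : Circle) (x y : boundary T), (x : A) ∈ eigenspace T lam →
    (y : A) ∈ eigenspace T mu →
    SOTTendsto (fun n => ((lam : ℂ) ^ n * (mu : ℂ) ^ n)⁻¹ • T^[n] ((x : A) * (y : A))) (m x y : A)

/-- The closed subspace `P ⊆ A`, with the norm and the involution of `A` and with the product `m`,
is a C*-algebra (not necessarily unital). -/
structure IsCStarAlgebra {A : VonNeumannAlgebra H} (P : Submodule ℂ A) (m : P →L[ℂ] P →L[ℂ] P) :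
    Prop where
  isClosed : IsClosed (P : Set A)
  star_mem : ∀ x ∈ P, star x ∈ P
  mul_assoc : ∀ x y z : P, m (m x y) z = m x (m y z)
  star_mul : ∀ x y : P, star (m x y : A) = m ⟨star y, star_mem y y.2⟩ ⟨star x, star_mem x x.2⟩
  norm_mul_le : ∀ x y : P, ‖m x y‖ ≤ ‖x‖ * ‖y‖
  norm_star_mul_self : ∀ x : P, ‖m ⟨star x, star_mem x x.2⟩ x‖ = ‖x‖ ^ 2

/-- `e` is a (two-sided) unit for the product `m`. -/
def IsUnitFor {A : VonNeumannAlgebra H} {P : Submodule ℂ A} (m : P →L[ℂ] P →L[ℂ] P) (e : P) :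
    Prop :=
  ∀ x : P, m e x = x ∧ m x e = x

/-- A contractive linear map `T : A → A` as a bounded linear map. -/
noncomputable def contraction {A : VonNeumannAlgebra H} (T : A →ₗ[ℂ] A)
    (hT : ∀ x : A, ‖T x‖ ≤ ‖x‖) : A →L[ℂ] A :=
  T.mkContinuous 1 fun x => by simpa using hT x

/-- `x` is a Perron–Frobenius eigenvector of the bounded map `T`: `x ≥ 0`, `‖x‖ = 1` and
`T x = r x` with `r` the spectral radius of `T`. -/
def IsPerronFrobenius {A : VonNeumannAlgebra H} (T : A →L[ℂ] A) (x : A) : Prop :=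
  0 ≤ x ∧ ‖x‖ = 1 ∧ T x = ((spectralRadius ℂ T).toReal : ℂ) • x

/-- `x` is a maximal Perron–Frobenius eigenvector: the greatest one in the order of `A`. -/
def IsMaximalPerronFrobenius {A : VonNeumannAlgebra H} (T : A →L[ℂ] A) (x : A) : Prop :=
  IsGreatest {y : A | IsPerronFrobenius T y} x

section Dilation

variable {K : Type*} [NormedAddCommGroup K] [InnerProductSpace ℂ K] [CompleteSpace K]

/-- For an isometry `V : H → K` and `x ∈ B(H)`, the operator `V x V*` on `K`, that is, `x` seen as
an operator on `K` which vanishes on the orthogonal complement of (the image of) `H`. -/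
noncomputable def corner (V : H →ₗᵢ[ℂ] K) (x : H →L[ℂ] H) : K →L[ℂ] K :=
  V.toContinuousLinearMap ∘L x ∘L ContinuousLinearMap.adjoint V.toContinuousLinearMap

/-- For an isometry `V : H → K` and `z ∈ B(K)`, the compression `V* z V` of `z` to `H`. -/
noncomputable def compress (V : H →ₗᵢ[ℂ] K) (z : K →L[ℂ] K) : H →L[ℂ] H :=
  ContinuousLinearMap.adjoint V.toContinuousLinearMap ∘L z ∘L V.toContinuousLinearMap

/-- The vector `θⁿ(xₙ) θⁿ⁻¹(xₙ₋₁) ⋯ θ(x₁) h` of `K`, for the list `[xₙ, …, x₁]`. -/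
noncomputable def dilationVector {B : VonNeumannAlgebra K} (θ : B → B) (V : H →ₗᵢ[ℂ] K) :
    List B → H → K
  | [], h => V h
  | x :: l, h => (θ^[l.length + 1] x : K →L[ℂ] K) (dilationVector θ V l h)

/-- `(K, B, θ)`, together with the isometry `V : H → K` which embeds `H` into `K`, is a minimal
dilation of `(H, A, T)`. With `p = V V*` the projection onto `H`:
`A = p B p`, `θ` is a normal *-endomorphism of `B`, `p θⁿ(z) p = Tⁿ(p z p)` for all `z ∈ B`,
`K` is the closed linear span of the vectors `θⁿ(xₙ) ⋯ θ(x₁) h` with `xᵢ ∈ A`, `h ∈ H`, and `B` is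
generated as a von Neumann algebra by the `θⁿ(x)` with `n ≥ 0`, `x ∈ A`. -/
structure MinimalDilation {A : VonNeumannAlgebra H} (T : A →ₗ[ℂ] A) (B : VonNeumannAlgebra K) where
  V : H →ₗᵢ[ℂ] K
  θ : B →⋆ₙₐ[ℂ] B
  normal : ScottContinuous θ
  corner_mem : ∀ x : A, corner V x ∈ B
  compress_mem : ∀ z : B, compress V z ∈ A
  dilates : ∀ (n : ℕ) (z : B), compress V (θ^[n] z) = T^[n] ⟨compress V z, compress_mem z⟩
  minimal : (Submodule.span ℂ {k : K | ∃ (l : List A) (h : H),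
    k = dilationVector θ V (l.map fun x : A => ⟨corner V x, corner_mem x⟩) h}).topologicalClosure = ⊤
  generates : ∀ C : VonNeumannAlgebra K,
    (∀ (n : ℕ) (x : A), (θ^[n] ⟨corner V x, corner_mem x⟩ : K →L[ℂ] K) ∈ C) → B ≤ C

/-- The *-endomorphism of a minimal dilation, as a linear map. -/
noncomputable def MinimalDilation.endo {A : VonNeumannAlgebra H} {T : A →ₗ[ℂ] A} {B : VonNeumannAlgebra K}
    (D : MinimalDilation T B) : B →ₗ[ℂ] B :=
  { toFun := D.θ
    map_add' := map_add D.θ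
    map_smul' := map_smul D.θ }

/-- `x ∘ y = p (x̂ ŷ) p` for a minimal dilation: every `x ∈ P(T)` has exactly one lift `x̂ ∈ P(θ)`,
that is, `p x̂ p = x`, and `m x y` is the compression of `x̂ ŷ` for the lifts `x̂`, `ŷ` of `x`, `y`. -/
def MinimalDilation.IsCompressedProduct {A : VonNeumannAlgebra H} {T : A →ₗ[ℂ] A}
    {B : VonNeumannAlgebra K} (D : MinimalDilation T B)
    (m : boundary T →L[ℂ] boundary T →L[ℂ] boundary T) : Prop :=
  (∀ x : boundary T, ∃! z : B, z ∈ boundary D.endo ∧ compress D.V z = (x : A)) ∧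
  ∀ (x y : boundary T) (z w : B), z ∈ boundary D.endo → w ∈ boundary D.endo →
    compress D.V z = (x : A) → compress D.V w = (y : A) →
    ((m x y : A) : H →L[ℂ] H) = compress D.V (z * w : B)

end Dilation

end PeripheralPoisson

namespace PeripheralPoisson

/-! ### The isometric action of a contraction on its peripheral space. -/

section Boundary

variable {H : Type*} [NormedAddCommGroup H] [InnerProductSpace ℂ H] [CompleteSpace H]
  {A : VonNeumannAlgebra H} {T : A →ₗ[ℂ] A}

/-! A contraction `T` acts on `P(T)` as a surjective isometry: the orbit of an element of `E(T)` is
almost periodic, hence returns arbitrarily close to its start, so no norm can be lost along it. Let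
`σ` be the inverse on `P(T)` (`back` is its power). For eigenvectors, the Choi–Effros sequence is
`Tⁿ(σⁿ(x) σⁿ(y))`, an expression that makes sense on all of `P(T)`. For the pair `(x*, x)` it
increases by the Kadison–Schwarz inequality (`monotone_approx`); being bounded it converges
strongly, and polarization gives the limit `x ∘ y` in general. Normality makes these limits survive
multiplication by fixed elements and powers of `T` (`PolyTendsto`), although `T` need not be
strongly continuous.

Associativity compares both bracketings with the limit of `Tᵏ(σᵏ(x) σᵏ(y) σᵏ(z))`. The failure of
`Tᵐ` to be multiplicative is a positive semidefinite form, and its Cauchy–Schwarz inequality bounds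
the error by a tail of the convergent sequence for `x ∘ x*` (`tendsto_vecForm_pow_mul`). The
C*-identity is the inequality `x* x ≤ x* ∘ x`, the first term against the limit. The same comparison
with the constant sequence `1` shows that `q = lim Tⁿ(1)` is a unit. Hence `q = 0` forces `P(T) =
0`, while `q ≠ 0` is itself a fixed point. Positive fixed points of norm at most one lie below every
`Tⁿ(1)`, hence below `q`, which gives maximality.

For a minimal dilation, matrix coefficients of `θⁿ(z)` between generating vectors of length at most
`n` depend only on the compression of `z` (`inner_dv_pow`). So the coefficients of `θⁿ(σⁿ(x))` are
eventually constant and define the lift of `x`, and an element of `P(θ)` with zero compression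
vanishes. Finally `θⁿ(1 - p) → 0` strongly, which identifies the compression of `x̂ ŷ` with the
Choi–Effros limit. -/

theorem mem_eigenspace_iff {lam : Circle} {x : A} :
    x ∈ eigenspace T lam ↔ T x = (lam : ℂ) • x :=
  Module.End.mem_eigenspace_iff

theorem pow_apply_of_mem_eigenspace {lam : Circle} {x : A} (hx : x ∈ eigenspace T lam) (n : ℕ) :
    (T ^ n) x = (lam : ℂ) ^ n • x := by
  induction n with
  | zero => simp
  | succ n ih =>
    rw [pow_succ', Module.End.mul_apply, ih, map_smul, mem_eigenspace_iff.1 hx, smul_smul,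
      pow_succ]

/-- The orbit of an element of `E(T)` is the restriction, to the powers of the identity, of a
continuous function on the compact group of all functions from the circle to itself. -/
theorem exists_continuous_orbit {x : A} (hx : x ∈ peripheralSpan T) :
    ∃ φ : (Circle → Circle) → A, Continuous φ ∧ φ 1 = x ∧ ∀ n : ℕ, φ (id ^ n) = (T ^ n) x := by
  induction hx using Submodule.span_induction with
  | mem x hx =>
    obtain ⟨lam, hx⟩ := hx
    refine ⟨fun g => (g lam : ℂ) • x, by fun_prop, by simp, fun n => ?_⟩
    rw [pow_apply_of_mem_eigenspace hx]
    simp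
  | zero => exact ⟨fun _ => 0, continuous_const, rfl, by simp⟩
  | add x y _ _ hx hy =>
    obtain ⟨φ, h1, h2, h3⟩ := hx
    obtain ⟨ψ, k1, k2, k3⟩ := hy
    exact ⟨fun g => φ g + ψ g, h1.add k1, by simp [h2, k2], fun n => by simp [h3, k3]⟩
  | smul c x _ hx =>
    obtain ⟨φ, h1, h2, h3⟩ := hx
    exact ⟨fun g => c • φ g, h1.const_smul c, by simp [h2], fun n => by simp [h3]⟩

theorem norm_pow_apply_le (hT : ∀ x : A, ‖T x‖ ≤ ‖x‖) (n : ℕ) (x : A) : ‖(T ^ n) x‖ ≤ ‖x‖ := by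
  induction n with
  | zero => simp
  | succ n ih => rw [pow_succ', Module.End.mul_apply]; exact (hT _).trans ih

/-- Recurrence: `x` is a cluster point of its own orbit, while every later orbit point has norm at
most `‖T x‖`. -/
theorem norm_map_of_mem_peripheralSpan (hT : ∀ x : A, ‖T x‖ ≤ ‖x‖) {x : A}
    (hx : x ∈ peripheralSpan T) : ‖T x‖ = ‖x‖ := by
  refine (hT x).antisymm ?_
  obtain ⟨φ, h1, h2, h3⟩ := exists_continuous_orbit hx
  -- In a compact group, the identity is a cluster point of the powers of any element; `φ` carries
  -- this to the orbit.
  have h4 : MapClusterPt x atTop (fun n : ℕ => (T ^ n) x) := by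
    have := (mapClusterPt_one_atTop_pow (id : Circle → Circle)).continuousAt_comp
      h1.continuousAt
    rw [h2] at this
    convert this using 2 with n
    exact (h3 n).symm
  have h5 : IsClosed {y : A | ‖y‖ ≤ ‖T x‖} := isClosed_le continuous_norm continuous_const
  refine h5.mem_of_mapClusterPt h4 ((eventually_ge_atTop 1).mono fun n hn => ?_)
  obtain ⟨k, rfl⟩ := Nat.exists_eq_add_of_le' hn
  rw [pow_succ, Module.End.mul_apply]
  exact norm_pow_apply_le hT k _

theorem continuous_of_contractive (hT : ∀ x : A, ‖T x‖ ≤ ‖x‖) : Continuous T :=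
  (contraction T hT).continuous

theorem norm_map_of_mem_boundary (hT : ∀ x : A, ‖T x‖ ≤ ‖x‖) {x : A}
    (hx : x ∈ boundary T) : ‖T x‖ = ‖x‖ := by
  have h : IsClosed {y : A | ‖T y‖ = ‖y‖} :=
    isClosed_eq (continuous_of_contractive hT).norm continuous_norm
  exact closure_minimal (fun y hy => norm_map_of_mem_peripheralSpan hT hy) h hx

theorem map_mem_boundary (hT : ∀ x : A, ‖T x‖ ≤ ‖x‖) {x : A} (hx : x ∈ boundary T) :
    T x ∈ boundary T := by
  refine map_mem_closure (continuous_of_contractive hT) hx fun y hy => ?_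
  induction hy using Submodule.span_induction with
  | mem x hx =>
    obtain ⟨lam, hx⟩ := hx
    change T x ∈ peripheralSpan T
    rw [mem_eigenspace_iff.1 hx]
    exact Submodule.smul_mem _ _ (Submodule.subset_span ⟨lam, hx⟩)
  | zero => simp
  | add x y _ _ hx hy => rw [map_add]; exact add_mem hx hy
  | smul c x _ hx => rw [map_smul]; exact Submodule.smul_mem (peripheralSpan T) _ hx

instance instCompleteSpaceBoundary : CompleteSpace (boundary T) :=
  (Submodule.isClosed_topologicalClosure _).completeSpace_coe

/-- A closed subspace of `P(T)` which contains all peripheral eigenvectors is everything. -/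
theorem map_mem_of_eigenvectors {X : Type*} [NormedAddCommGroup X] [NormedSpace ℂ X]
    (f : boundary T →L[ℂ] X) (S : Submodule ℂ X) (hS : IsClosed (S : Set X))
    (h : ∀ (lam : Circle) (x : boundary T), (x : A) ∈ eigenspace T lam → f x ∈ S)
    (x : boundary T) : f x ∈ S := by
  have hspan : ∀ (y : A) (hy : y ∈ peripheralSpan T),
      f ⟨y, (peripheralSpan T).le_topologicalClosure hy⟩ ∈ S := by
    intro y hy
    induction hy using Submodule.span_induction with
    | mem x hx => obtain ⟨lam, hx⟩ := hx; exact h lam ⟨x, _⟩ hx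
    | zero => convert S.zero_mem; exact map_zero f
    | add x y hx hy ihx ihy =>
      convert S.add_mem ihx ihy
      rw [← map_add]; rfl
    | smul c x hx ih =>
      convert S.smul_mem c ih
      rw [← map_smul]; rfl
  have hd : Dense {y : boundary T | (y : A) ∈ peripheralSpan T} := by
    intro y
    rw [Topology.IsInducing.subtypeVal.closure_eq_preimage_closure_image]
    refine closure_mono (fun z hz => ?_) y.2
    exact ⟨⟨z, (peripheralSpan T).le_topologicalClosure hz⟩, hz, rfl⟩
  have hcl : IsClosed {y : boundary T | f y ∈ S} := hS.preimage f.continuous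
  exact closure_minimal (s := {y : boundary T | (y : A) ∈ peripheralSpan T})
    (fun y hy => hspan y hy) hcl (hd x)

theorem eq_of_eigenvectors {X : Type*} [NormedAddCommGroup X] [NormedSpace ℂ X]
    {f g : boundary T →L[ℂ] X}
    (h : ∀ (lam : Circle) (x : boundary T), (x : A) ∈ eigenspace T lam → f x = g x) : f = g := by
  ext x
  have := map_mem_of_eigenvectors (f - g) ⊥ isClosed_singleton
    (fun lam x hx => by simp [h lam x hx]) x
  simpa [sub_eq_zero] using this

/-- A contraction acts isometrically on its peripheral space `P(T)`. -/
noncomputable def boundaryIsometry (hT : ∀ x : A, ‖T x‖ ≤ ‖x‖) : boundary T →ₗᵢ[ℂ] boundary T where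
  toLinearMap := T.restrict fun _ hx => map_mem_boundary hT hx
  norm_map' x := norm_map_of_mem_boundary hT x.2

/-- The range of an isometry on a complete space is closed, and it contains every peripheral
eigenvector because the eigenvalue is invertible. -/
theorem boundaryIsometry_surjective (hT : ∀ x : A, ‖T x‖ ≤ ‖x‖) :
    Function.Surjective (boundaryIsometry hT) := by
  intro x
  refine map_mem_of_eigenvectors (.id ℂ (boundary T))
    (LinearMap.range (boundaryIsometry hT).toLinearMap) ?_ (fun lam x hx => ?_) x
  · exact (boundaryIsometry hT).isometry.isClosedEmbedding.isClosed_range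
  · refine ⟨(lam : ℂ)⁻¹ • x, Subtype.ext ?_⟩
    change T ((lam : ℂ)⁻¹ • (x : A)) = x
    rw [map_smul, mem_eigenspace_iff.1 hx, smul_smul, inv_mul_cancel₀ lam.coe_ne_zero, one_smul]

/-- The restriction of a contraction to its peripheral space `P(T)`, an isometric isomorphism. -/
noncomputable def boundaryEquiv (hT : ∀ x : A, ‖T x‖ ≤ ‖x‖) : boundary T ≃ₗᵢ[ℂ] boundary T :=
  LinearIsometryEquiv.ofSurjective (boundaryIsometry hT) (boundaryIsometry_surjective hT)

theorem coe_boundaryEquiv (hT : ∀ x : A, ‖T x‖ ≤ ‖x‖) (x : boundary T) :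
    (boundaryEquiv hT x : A) = T x := rfl

/-- The `n`-th power of the inverse of the restriction of `T` to `P(T)`. -/
noncomputable def back (hT : ∀ x : A, ‖T x‖ ≤ ‖x‖) (n : ℕ) : boundary T →ₗ[ℂ] boundary T :=
  ((boundaryEquiv hT).symm.toLinearEquiv : boundary T →ₗ[ℂ] boundary T) ^ n

variable (hT : ∀ x : A, ‖T x‖ ≤ ‖x‖)

@[simp] theorem back_zero (x : boundary T) : back hT 0 x = x := rfl

theorem back_add (m n : ℕ) (x : boundary T) : back hT (m + n) x = back hT m (back hT n x) := by
  simp [back, pow_add]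

@[simp] theorem norm_back (n : ℕ) (x : boundary T) : ‖back hT n x‖ = ‖x‖ := by
  induction n with
  | zero => rfl
  | succ n ih =>
    rw [add_comm, back_add, ← ih]
    exact (boundaryEquiv hT).symm.norm_map _

theorem map_back_succ (n : ℕ) (x : boundary T) : T (back hT (n + 1) x) = back hT n x := by
  rw [add_comm, back_add, ← coe_boundaryEquiv hT]
  exact congrArg Subtype.val ((boundaryEquiv hT).apply_symm_apply _)

theorem pow_back (m n : ℕ) (x : boundary T) : (T ^ m) (back hT (m + n) x) = back hT n x := by
  induction m generalizing n with
  | zero => simp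
  | succ m ih =>
    rw [pow_succ', Module.End.mul_apply, add_assoc, ih (1 + n), add_comm 1 n, map_back_succ]

theorem pow_back_self (n : ℕ) (x : boundary T) : (T ^ n) (back hT n x) = x :=
  pow_back hT n 0 x

/-- `back` is determined by the injectivity of `Tⁿ` on `P(T)`. -/
theorem back_eq_of_pow {n : ℕ} {x y : boundary T} (h : (T ^ n) y = x) : back hT n x = y := by
  have hinj : ∀ (n : ℕ) (z : boundary T), (T ^ n) z = 0 → z = 0 := by
    intro n
    induction n with
    | zero => exact fun z hz => Subtype.ext hz
    | succ n ih =>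
      intro z hz
      rw [pow_succ, Module.End.mul_apply] at hz
      have h1 := ih (boundaryEquiv hT z) hz
      simpa using h1
  refine sub_eq_zero.1 (hinj n _ ?_)
  rw [AddSubgroupClass.coe_sub, map_sub, pow_back_self, h, sub_self]

theorem back_of_mem_eigenspace {lam : Circle} {x : boundary T} (hx : (x : A) ∈ eigenspace T lam)
    (n : ℕ) : back hT n x = ((lam : ℂ) ^ n)⁻¹ • x := by
  refine back_eq_of_pow hT ?_
  rw [Submodule.coe_smul, map_smul, pow_apply_of_mem_eigenspace hx, smul_smul,
    inv_mul_cancel₀ (pow_ne_zero _ lam.coe_ne_zero), one_smul]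

end Boundary

/-! ### Vector forms, strong limits and bounded monotone sequences. -/

section StrongConvergence

open scoped ComplexOrder

variable {H : Type*} [NormedAddCommGroup H] [InnerProductSpace ℂ H] [CompleteSpace H]
  {A : VonNeumannAlgebra H}

/-- The vector functional `a ↦ ⟪h, a h⟫`. -/
noncomputable def vecForm (h : H) : A →ₗ[ℂ] ℂ where
  toFun a := inner ℂ h ((a : H →L[ℂ] H) h)
  map_add' a b := by simp
  map_smul' c a := by
    change inner ℂ h (c • (a : H →L[ℂ] H) h) = _
    rw [inner_smul_right]; rfl

theorem vecForm_apply (h : H) (a : A) : vecForm h a = inner ℂ h ((a : H →L[ℂ] H) h) := rfl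

theorem vecForm_star (h : H) (a : A) : vecForm h (star a) = star (vecForm h a) := by
  change inner ℂ h (ContinuousLinearMap.adjoint (a : H →L[ℂ] H) h) = star (inner ℂ h _)
  rw [ContinuousLinearMap.adjoint_inner_right]
  exact (inner_conj_symm _ _).symm

theorem norm_vecForm_le (h : H) (a : A) : ‖vecForm h a‖ ≤ ‖a‖ * ‖h‖ ^ 2 := by
  refine (norm_inner_le_norm _ _).trans ?_
  have := (a : H →L[ℂ] H).le_opNorm h
  calc ‖h‖ * ‖(a : H →L[ℂ] H) h‖ ≤ ‖h‖ * (‖(a : H →L[ℂ] H)‖ * ‖h‖) := by gcongr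
    _ = ‖a‖ * ‖h‖ ^ 2 := by
      change _ = ‖(a : H →L[ℂ] H)‖ * ‖h‖ ^ 2
      ring

theorem ext_vecForm {a b : A} (hab : ∀ h, vecForm h a = vecForm h b) : a = b := by
  refine Subtype.ext (ContinuousLinearMap.coe_injective ?_)
  rw [← ext_inner_map]
  intro h
  rw [← inner_conj_symm, ← inner_conj_symm (b.1.toLinearMap h)]
  exact congrArg _ (hab h)

theorem nonneg_iff_vecForm {a : A} : 0 ≤ a ↔ ∀ h, 0 ≤ vecForm h a := by
  constructor
  · intro ha h
    have : (0 : H →L[ℂ] H) ≤ a := ha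
    exact ((ContinuousLinearMap.nonneg_iff_isPositive _).1 this).inner_nonneg_right h
  · intro ha
    change (0 : H →L[ℂ] H) ≤ a
    rw [ContinuousLinearMap.nonneg_iff_isPositive, ContinuousLinearMap.isPositive_iff_complex]
    intro h
    have h1 := ha h
    rw [vecForm_apply, ← inner_conj_symm, Complex.le_def] at h1
    simp only [Complex.zero_re, Complex.conj_re, Complex.zero_im, Complex.conj_im] at h1
    refine ⟨?_, h1.1⟩
    apply Complex.ext
    · simp
    · simp only [Complex.ofReal_im]
      linarith [h1.2]

theorem le_iff_vecForm {a b : A} : a ≤ b ↔ ∀ h, vecForm h a ≤ vecForm h b := by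
  rw [← sub_nonneg, nonneg_iff_vecForm]
  simp [sub_nonneg]

/-- Factor `a = s* s` and bound the outer `s*` by its norm. For increasing sequences this upgrades
convergence of the quadratic forms to strong convergence. -/
theorem norm_apply_sq_le_of_nonneg {a : A} (ha : 0 ≤ a) (h : H) :
    ‖(a : H →L[ℂ] H) h‖ ^ 2 ≤ ‖a‖ * (vecForm h a).re := by
  obtain ⟨s, rfl⟩ := CStarAlgebra.nonneg_iff_eq_star_mul_self.1 ha
  have h1 : ‖(s : H →L[ℂ] H) h‖ ^ 2 = (vecForm h (star s * s)).re :=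
    (s : H →L[ℂ] H).apply_norm_sq_eq_inner_adjoint_right h
  have h2 : ‖((star s * s : A) : H →L[ℂ] H) h‖ ≤ ‖s‖ * ‖(s : H →L[ℂ] H) h‖ := by
    rw [← norm_star s]
    exact ((star s : A) : H →L[ℂ] H).le_opNorm _
  rw [CStarRing.norm_star_mul_self, ← h1]
  calc _ ≤ (‖s‖ * ‖(s : H →L[ℂ] H) h‖) ^ 2 := by gcongr
    _ = _ := by ring

namespace SOTTendsto

variable {a a' : ℕ → A} {b b' : A}

theorem const (b : A) : SOTTendsto (fun _ => b) b := fun _ => tendsto_const_nhds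

theorem add (h : SOTTendsto a b) (h' : SOTTendsto a' b') :
    SOTTendsto (fun n => a n + a' n) (b + b') := fun k => by
  simpa using (h k).add (h' k)

theorem smul (c : ℂ) (h : SOTTendsto a b) : SOTTendsto (fun n => c • a n) (c • b) := fun k =>
  (h k).const_smul c

theorem vecForm (h : SOTTendsto a b) (k : H) :
    Tendsto (fun n => vecForm k (a n)) atTop (𝓝 (PeripheralPoisson.vecForm k b)) :=
  tendsto_const_nhds.inner (h k)

theorem unique (h : SOTTendsto a b) (h' : SOTTendsto a b') : b = b' :=
  Subtype.ext (ContinuousLinearMap.ext fun k => tendsto_nhds_unique (h k) (h' k))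

theorem norm_le (h : SOTTendsto a b) {C : ℝ} (hC : ∀ n, ‖a n‖ ≤ C) : ‖b‖ ≤ C := by
  have h0 : 0 ≤ C := (norm_nonneg _).trans (hC 0)
  refine ContinuousLinearMap.opNorm_le_bound _ h0 fun k => ?_
  refine le_of_tendsto (h k).norm (Eventually.of_forall fun n => ?_)
  exact ((a n : H →L[ℂ] H).le_opNorm k).trans (by gcongr; exact hC n)

theorem comp_add (h : SOTTendsto a b) (m : ℕ) : SOTTendsto (fun n => a (n + m)) b := fun k =>
  (tendsto_add_atTop_iff_nat (f := fun n => (a n : H →L[ℂ] H) k) m).2 (h k)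

theorem mul_left (c : A) (h : SOTTendsto a b) : SOTTendsto (fun n => c * a n) (c * b) := fun k =>
  ((c : H →L[ℂ] H).continuous.tendsto _).comp (h k)

theorem mul_right (c : A) (h : SOTTendsto a b) : SOTTendsto (fun n => a n * c) (b * c) := fun k =>
  h ((c : H →L[ℂ] H) k)

theorem le_of_monotone (h : SOTTendsto a b) (ha : Monotone a) (n : ℕ) : a n ≤ b := by
  rw [le_iff_vecForm]
  intro k
  refine ge_of_tendsto (h.vecForm k) ?_
  filter_upwards [eventually_ge_atTop n] with m hm
  exact le_iff_vecForm.1 (ha hm) k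

theorem le_of_forall_le (h : SOTTendsto a b) {c : A} (hc : ∀ n, a n ≤ c) : b ≤ c := by
  rw [le_iff_vecForm]
  intro k
  exact le_of_tendsto (h.vecForm k) (Eventually.of_forall fun n => le_iff_vecForm.1 (hc n) k)

theorem ge_of_forall_ge (h : SOTTendsto a b) {c : A} (hc : ∀ n, c ≤ a n) : c ≤ b := by
  rw [le_iff_vecForm]
  intro k
  exact ge_of_tendsto (h.vecForm k) (Eventually.of_forall fun n => le_iff_vecForm.1 (hc n) k)

theorem isLUB (h : SOTTendsto a b) (ha : Monotone a) : IsLUB (Set.range a) b := by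
  refine ⟨?_, fun c hc => h.le_of_forall_le fun n => hc ⟨n, rfl⟩⟩
  rintro _ ⟨n, rfl⟩
  exact h.le_of_monotone ha n

end SOTTendsto

/-- A von Neumann algebra is closed under strong limits of sequences. -/
theorem mem_of_tendsto_apply {a : ℕ → A} {g : H →L[ℂ] H}
    (hg : ∀ h, Tendsto (fun n => (a n : H →L[ℂ] H) h) atTop (𝓝 (g h))) : g ∈ A := by
  rw [← A.commutant_commutant, VonNeumannAlgebra.mem_commutant_iff]
  intro z hz
  ext h
  refine tendsto_nhds_unique (f := fun n => z ((a n : H →L[ℂ] H) h))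
    ((z.continuous.tendsto _).comp (hg h)) ?_
  refine (hg (z h)).congr fun n => ?_
  exact DFunLike.congr_fun (VonNeumannAlgebra.mem_commutant_iff.1 hz _ (a n).2) h

/-- A bounded increasing sequence in a von Neumann algebra converges strongly. -/
theorem exists_sotTendsto_of_monotone {a : ℕ → A} (ha : Monotone a) {C : ℝ}
    (hC : ∀ n, ‖a n‖ ≤ C) : ∃ b, SOTTendsto a b := by
  have hcauchy : ∀ h : H, CauchySeq fun n => (a n : H →L[ℂ] H) h := by
    intro h
    have hmono : Monotone fun n => (vecForm h (a n)).re := fun m n hmn =>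
      (Complex.le_def.1 (le_iff_vecForm.1 (ha hmn) h)).1
    have hbdd : BddAbove (Set.range fun n => (vecForm h (a n)).re) := by
      refine ⟨C * ‖h‖ ^ 2, ?_⟩
      rintro _ ⟨n, rfl⟩
      refine ((Complex.re_le_norm _).trans (norm_vecForm_le h (a n))).trans ?_
      gcongr
      exact hC n
    have hlim := tendsto_atTop_ciSup hmono hbdd
    set r := ⨆ n, (vecForm h (a n)).re
    refine cauchySeq_of_le_tendsto_0'
      (fun n => Real.sqrt ((2 * C) * (r - (vecForm h (a n)).re))) (fun n m hnm => ?_) ?_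
    · rw [dist_comm, dist_eq_norm]
      refine Real.le_sqrt_of_sq_le ?_
      have h1 := norm_apply_sq_le_of_nonneg (sub_nonneg.2 (ha hnm)) h
      have h2 : ‖a m - a n‖ ≤ 2 * C := (norm_sub_le _ _).trans (by linarith [hC m, hC n])
      have h3 : (vecForm h (a m - a n)).re ≤ r - (vecForm h (a n)).re := by
        rw [map_sub, Complex.sub_re]
        linarith [le_ciSup hbdd m]
      have h4 : 0 ≤ (vecForm h (a m - a n)).re := by
        rw [map_sub, Complex.sub_re]
        linarith [hmono hnm]
      refine (le_of_eq ?_).trans (h1.trans ?_)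
      · simp
      · gcongr
        exact (norm_nonneg _).trans h2
    · have := ((tendsto_const_nhds (x := r)).sub hlim).const_mul (2 * C)
      simpa [Function.comp_def] using (Real.continuous_sqrt.tendsto _).comp this
  choose f hf using fun h => cauchySeq_tendsto_of_complete (hcauchy h)
  let g : H →L[ℂ] H := continuousLinearMapOfTendsto (fun n => (a n : H →L[ℂ] H))
    (tendsto_pi_nhds.2 hf)
  exact ⟨⟨g, mem_of_tendsto_apply (a := a) (g := g) hf⟩, hf⟩

end StrongConvergence

/-! ### The Kadison–Schwarz inequality. -/

section KadisonSchwarz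

variable {B : Type*} [CStarAlgebra B] [PartialOrder B] [StarOrderedRing B]

theorem exists_eq_star_mul_self {a : B} (ha : 0 ≤ a) : ∃ b, a = star b * b :=
  CStarAlgebra.nonneg_iff_eq_star_mul_self.1 ha

/-- The Kadison–Schwarz inequality for contractive completely positive maps. -/
theorem star_map_mul_map_le {τ : B →CP B} (hτ : ∀ x : B, ‖τ x‖ ≤ ‖x‖) (x : B) :
    star (τ x) * τ x ≤ τ (star x * x) := by
  -- `S* S` is the matrix with rows `(1, x)` and `(x*, x* x)`; 2-positivity keeps its entrywise
  -- image positive, so that image is some `R* R`.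
  let S : CStarMatrix (Fin 2) (Fin 2) B := CStarMatrix.ofMatrix !![1, x; 0, 0]
  have hS : 0 ≤ (star S * S).map τ := τ.map_cstarMatrix_nonneg _ (star_mul_self_nonneg S)
  obtain ⟨R, hR⟩ := exists_eq_star_mul_self hS
  have hent : ∀ i j, τ ((star S * S) i j) = (star R * R) i j := fun i j => by
    rw [← hR]; rfl
  have e00 := hent 0 0
  have e01 := hent 0 1
  have e10 := hent 1 0
  have e11 := hent 1 1
  simp only [CStarMatrix.mul_apply, CStarMatrix.star_apply, Fin.sum_univ_two] at e00 e01 e10 e11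
  simp [S] at e00 e01 e10 e11
  have hone : τ 1 ≤ 1 := by
    rw [← CStarAlgebra.norm_le_one_iff_of_nonneg _ (map_nonneg τ zero_le_one)]
    refine (hτ 1).trans ?_
    rw [CStarAlgebra.norm_le_one_iff_of_nonneg _ zero_le_one]
  have h1 : star (τ x) * τ 1 * τ x ≤ star (τ x) * 1 * τ x :=
    star_left_conjugate_le_conjugate hone _
  set v := τ x with hv
  have e10' : star v = star (R 0 1) * R 0 0 + star (R 1 1) * R 1 0 := by
    rw [← e10, map_star]
  -- Evaluation of the positive matrix `R* R` on the column `(-v, 1)`. It gives `τ(x* x) - 2 v* v +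
  -- v* τ(1) v ≥ 0`, and `τ(1) ≤ 1` absorbs one `v* v`.
  have h2 : 0 ≤ star (R 0 1 - R 0 0 * v) * (R 0 1 - R 0 0 * v) +
      star (R 1 1 - R 1 0 * v) * (R 1 1 - R 1 0 * v) :=
    add_nonneg (star_mul_self_nonneg _) (star_mul_self_nonneg _)
  have h3 : star (R 0 1 - R 0 0 * v) * (R 0 1 - R 0 0 * v) +
      star (R 1 1 - R 1 0 * v) * (R 1 1 - R 1 0 * v) =
      τ (star x * x) - star v * (star (R 0 0) * R 0 1 + star (R 1 0) * R 1 1)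
        - (star (R 0 1) * R 0 0 + star (R 1 1) * R 1 0) * v + star v * τ 1 * v := by
    rw [e11, e00]
    simp only [star_sub, star_mul]
    noncomm_ring
  rw [h3, ← e01, ← e10'] at h2
  rw [mul_one] at h1
  have h4 := add_le_add h2 h1
  rw [← sub_nonneg] at h4 ⊢
  refine h4.trans_eq ?_
  noncomm_ring

end KadisonSchwarz

/-! ### Normal Schwarz maps, polarization and preservation of strong limits. -/

section NormalSchwarz

variable {H : Type*} [NormedAddCommGroup H] [InnerProductSpace ℂ H] [CompleteSpace H]
  {A : VonNeumannAlgebra H}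

/-- Normal contractions which are positive and satisfy the Kadison–Schwarz inequality. -/
structure IsNormalSchwarz (T : A →ₗ[ℂ] A) : Prop where
  norm_map_le : ∀ x : A, ‖T x‖ ≤ ‖x‖
  monotone : Monotone T
  map_star : ∀ x : A, T (star x) = star (T x)
  schwarz : ∀ x : A, star (T x) * T x ≤ T (star x * x)
  normal : ScottContinuous T

end NormalSchwarz

section Polarization

variable {R : Type*} [Ring R] [StarRing R] [Algebra ℂ R] [StarModule ℂ R]

theorem star_mul_mul_polarization (e a d : R) : star e * a * d =
    (1 / 4 : ℂ) • (star (e + d) * a * (e + d) + (-1 : ℂ) • (star (e - d) * a * (e - d)) +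
      (-Complex.I) • (star (e + Complex.I • d) * a * (e + Complex.I • d)) +
      Complex.I • (star (e - Complex.I • d) * a * (e - Complex.I • d))) := by
  simp only [star_add, star_sub, star_smul, add_mul, sub_mul, mul_add, mul_sub, smul_mul_assoc,
    mul_smul_comm, smul_smul, smul_add, smul_sub, Complex.star_def, Complex.conj_I]
  have h1 : Complex.I * Complex.I = -1 := Complex.I_mul_I
  simp only [mul_neg, neg_mul, neg_neg, mul_assoc, h1, mul_one]
  module

end Polarization

section PolyTendsto

variable {H : Type*} [NormedAddCommGroup H] [InnerProductSpace ℂ H] [CompleteSpace H]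
  {A : VonNeumannAlgebra H} {T : A →ₗ[ℂ] A}

/-- Strong convergence which is preserved by all the maps `a ↦ Tⁿ(c a d)`. -/
def PolyTendsto (T : A →ₗ[ℂ] A) (a : ℕ → A) (b : A) : Prop :=
  ∀ (n : ℕ) (c d : A), SOTTendsto (fun m => (T ^ n) (c * a m * d)) ((T ^ n) (c * b * d))

namespace PolyTendsto

variable {a a' : ℕ → A} {b b' : A}

theorem add (h : PolyTendsto T a b) (h' : PolyTendsto T a' b') :
    PolyTendsto T (fun n => a n + a' n) (b + b') := fun n c d => by
  simpa only [mul_add, add_mul, map_add] using (h n c d).add (h' n c d)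

theorem smul (r : ℂ) (h : PolyTendsto T a b) : PolyTendsto T (fun n => r • a n) (r • b) :=
  fun n c d => by
    simpa only [mul_smul_comm, smul_mul_assoc, map_smul] using (h n c d).smul r

theorem const (b : A) : PolyTendsto T (fun _ => b) b := fun _ _ _ => SOTTendsto.const _

theorem pow (h : PolyTendsto T a b) (n : ℕ) :
    SOTTendsto (fun m => (T ^ n) (a m)) ((T ^ n) b) := by
  simpa using h n 1 1

theorem sot (h : PolyTendsto T a b) : SOTTendsto a b := h.pow 0

end PolyTendsto

namespace IsNormalSchwarz

variable (hT : IsNormalSchwarz T)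
include hT

theorem monotone_pow (n : ℕ) : Monotone (T ^ n) := by
  induction n with
  | zero => exact fun _ _ h => h
  | succ n ih =>
    intro x y h
    rw [pow_succ, Module.End.mul_apply, Module.End.mul_apply]
    exact ih (hT.monotone h)

theorem pow_star (n : ℕ) (x : A) : (T ^ n) (star x) = star ((T ^ n) x) := by
  induction n generalizing x with
  | zero => rfl
  | succ n ih => rw [pow_succ, Module.End.mul_apply, Module.End.mul_apply, hT.map_star, ih]

theorem schwarz_pow (n : ℕ) (x : A) : star ((T ^ n) x) * (T ^ n) x ≤ (T ^ n) (star x * x) := by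
  induction n generalizing x with
  | zero => exact le_rfl
  | succ n ih =>
    simp only [pow_succ, Module.End.mul_apply]
    exact (ih _).trans (hT.monotone_pow n (hT.schwarz x))

/-- The strong limit of a bounded increasing sequence is its supremum, and normality preserves
suprema of directed sets; the image sequence is again bounded and increasing, so the argument
iterates. -/
theorem sotTendsto_pow_of_monotone {a : ℕ → A} {b : A} (ha : Monotone a) {C : ℝ}
    (hC : ∀ n, ‖a n‖ ≤ C) (h : SOTTendsto a b) (n : ℕ) :
    SOTTendsto (fun m => (T ^ n) (a m)) ((T ^ n) b) := by
  induction n generalizing a b with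
  | zero => exact h
  | succ n ih =>
    simp only [pow_succ, Module.End.mul_apply]
    have hmono : Monotone fun m => T (a m) := hT.monotone.comp ha
    have hbdd : ∀ m, ‖T (a m)‖ ≤ C := fun m => (hT.norm_map_le _).trans (hC m)
    refine ih hmono hbdd ?_
    obtain ⟨c, hc⟩ := exists_sotTendsto_of_monotone hmono hbdd
    have h1 := hT.normal (Set.range_nonempty a) (directedOn_range.2 ha.directed_le) (h.isLUB ha)
    rw [← Set.range_comp] at h1
    rwa [h1.unique (hc.isLUB hmono)]

/-- Conjugations `e* a e` keep the sequence increasing, so normality applies to them; a two-sided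
product `c a d` is a combination of four such conjugations, with `e = c* + iᵏ d`. -/
theorem polyTendsto_of_monotone {a : ℕ → A} {b : A} (ha : Monotone a) {C : ℝ}
    (hC : ∀ n, ‖a n‖ ≤ C) (h : SOTTendsto a b) : PolyTendsto T a b := by
  intro n c d
  have key : ∀ e : A,
      SOTTendsto (fun m => (T ^ n) (star e * a m * e)) ((T ^ n) (star e * b * e)) := by
    intro e
    refine hT.sotTendsto_pow_of_monotone (C := ‖star e‖ * C * ‖e‖)
      (fun i j hij => star_left_conjugate_le_conjugate (ha hij) e) (fun m => ?_)
      ((h.mul_left _).mul_right _) n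
    refine (norm_mul_le _ _).trans ?_
    gcongr
    refine (norm_mul_le _ _).trans ?_
    gcongr
    exact hC m
  have h4 := ((((key (star c + d)).add ((key (star c - d)).smul (-1))).add
    ((key (star c + Complex.I • d)).smul (-Complex.I))).add
    ((key (star c - Complex.I • d)).smul Complex.I)).smul (1 / 4)
  simp only [← map_smul, ← map_add, ← star_mul_mul_polarization, star_star] at h4
  exact h4

end IsNormalSchwarz

end PolyTendsto

section Star

variable {H : Type*} [NormedAddCommGroup H] [InnerProductSpace ℂ H] [CompleteSpace H]
  {A : VonNeumannAlgebra H} {T : A →ₗ[ℂ] A}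

theorem star_mem_boundary (hs : ∀ x : A, T (star x) = star (T x)) {x : A}
    (hx : x ∈ boundary T) : star x ∈ boundary T := by
  refine map_mem_closure continuous_star hx fun y hy => ?_
  induction hy using Submodule.span_induction with
  | mem x hx =>
    obtain ⟨lam, hx⟩ := hx
    refine Submodule.subset_span ⟨lam⁻¹, mem_eigenspace_iff.2 ?_⟩
    rw [hs, mem_eigenspace_iff.1 hx, star_smul, Circle.coe_inv_eq_conj]
    rfl
  | zero => simp
  | add x y _ _ hx hy => rw [star_add]; exact add_mem hx hy
  | smul c x _ hx => rw [star_smul]; exact Submodule.smul_mem (peripheralSpan T) _ hx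

end Star

/-! ### Construction of the Choi–Effros product. -/

section Product

variable {H : Type*} [NormedAddCommGroup H] [InnerProductSpace ℂ H] [CompleteSpace H]
  {A : VonNeumannAlgebra H} {T : A →ₗ[ℂ] A}

namespace IsNormalSchwarz

variable (hT : IsNormalSchwarz T)

/-- The involution of `A`, restricted to `P(T)`. -/
noncomputable def bstar (x : boundary T) : boundary T := ⟨star (x : A), star_mem_boundary hT.map_star x.2⟩

@[simp] theorem coe_bstar (x : boundary T) : (hT.bstar x : A) = star (x : A) := rfl

@[simp] theorem bstar_bstar (x : boundary T) : hT.bstar (hT.bstar x) = x :=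
  Subtype.ext (star_star _)

@[simp] theorem norm_bstar (x : boundary T) : ‖hT.bstar x‖ = ‖x‖ := norm_star (x : A)

theorem back_bstar (n : ℕ) (x : boundary T) :
    back hT.norm_map_le n (hT.bstar x) = hT.bstar (back hT.norm_map_le n x) := by
  refine back_eq_of_pow _ ?_
  rw [coe_bstar, hT.pow_star, pow_back_self]
  rfl

/-- The elements `Tⁿ(σⁿ(x) σⁿ(y))`, with `σ` the inverse of `T` on `P(T)`, which converge to the
Choi–Effros product of `x` and `y`. -/
noncomputable def approx (n : ℕ) (x y : boundary T) : A :=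
  (T ^ n) ((back hT.norm_map_le n x : A) * (back hT.norm_map_le n y : A))

theorem norm_approx_le (n : ℕ) (x y : boundary T) : ‖hT.approx n x y‖ ≤ ‖x‖ * ‖y‖ := by
  refine (norm_pow_apply_le hT.norm_map_le n _).trans ((norm_mul_le _ _).trans ?_)
  rw [← norm_back hT.norm_map_le n x, ← norm_back hT.norm_map_le n y]
  rfl

theorem approx_add_left (n : ℕ) (x x' y : boundary T) :
    hT.approx n (x + x') y = hT.approx n x y + hT.approx n x' y := by
  simp [approx, add_mul]

theorem approx_add_right (n : ℕ) (x y y' : boundary T) :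
    hT.approx n x (y + y') = hT.approx n x y + hT.approx n x y' := by
  simp [approx, mul_add]

theorem approx_smul_left (n : ℕ) (c : ℂ) (x y : boundary T) :
    hT.approx n (c • x) y = c • hT.approx n x y := by
  simp [approx]

theorem approx_smul_right (n : ℕ) (c : ℂ) (x y : boundary T) :
    hT.approx n x (c • y) = c • hT.approx n x y := by
  simp [approx]

theorem star_approx (n : ℕ) (x y : boundary T) :
    star (hT.approx n x y) = hT.approx n (hT.bstar y) (hT.bstar x) := by
  simp [approx, back_bstar, ← hT.pow_star]

/-- Moving the approximants of the product by `T`. -/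
theorem pow_approx_back (m n : ℕ) (x y : boundary T) :
    (T ^ n) (hT.approx m (back hT.norm_map_le n x) (back hT.norm_map_le n y)) =
      hT.approx (n + m) x y := by
  simp only [approx]
  rw [← back_add, ← back_add, pow_add, Module.End.mul_apply, add_comm m n]

/-- Since `σⁿ(x) = T(σⁿ⁺¹(x))`, one step is the Schwarz inequality at `σⁿ⁺¹(x)`, pushed forward by
the positive map `Tⁿ`. -/
theorem monotone_approx (x : boundary T) : Monotone fun n => hT.approx n (hT.bstar x) x := by
  refine monotone_nat_of_le_succ fun n => ?_
  have h := hT.monotone_pow n (hT.schwarz (back hT.norm_map_le (n + 1) x))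
  rw [map_back_succ] at h
  simp only [approx, back_bstar]
  rwa [pow_succ, Module.End.mul_apply]

theorem exists_polyTendsto (x y : boundary T) :
    ∃ b, PolyTendsto T (fun n => hT.approx n x y) b := by
  have key : ∀ z : boundary T, ∃ b, PolyTendsto T (fun n => hT.approx n (hT.bstar z) z) b := by
    intro z
    have hb := fun n => hT.norm_approx_le n (hT.bstar z) z
    obtain ⟨b, hb'⟩ := exists_sotTendsto_of_monotone (hT.monotone_approx z) hb
    exact ⟨b, hT.polyTendsto_of_monotone (hT.monotone_approx z) hb hb'⟩
  -- Polarization with the first variable replaced by its adjoint, so that every term is an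
  -- increasing sequence up to a scalar.
  have hpol : ∀ n, hT.approx n x y = (1 / 4 : ℂ) •
      (hT.approx n (hT.bstar (hT.bstar x + y)) (hT.bstar x + y) +
      (-1 : ℂ) • hT.approx n (hT.bstar (hT.bstar x - y)) (hT.bstar x - y) +
      (-Complex.I) • hT.approx n (hT.bstar (hT.bstar x + Complex.I • y))
        (hT.bstar x + Complex.I • y) +
      Complex.I • hT.approx n (hT.bstar (hT.bstar x - Complex.I • y))
        (hT.bstar x - Complex.I • y)) := by
    intro n
    have := star_mul_mul_polarization (star (back hT.norm_map_le n x : A)) 1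
      (back hT.norm_map_le n y : A)
    simp only [star_star, mul_one] at this
    simp only [approx, ← map_add, ← map_smul]
    rw [this]
    simp [back_bstar]
  obtain ⟨b₁, h₁⟩ := key (hT.bstar x + y)
  obtain ⟨b₂, h₂⟩ := key (hT.bstar x - y)
  obtain ⟨b₃, h₃⟩ := key (hT.bstar x + Complex.I • y)
  obtain ⟨b₄, h₄⟩ := key (hT.bstar x - Complex.I • y)
  have h := (((h₁.add (h₂.smul (-1))).add (h₃.smul (-Complex.I))).add
    (h₄.smul Complex.I)).smul (1 / 4)
  simp only [← hpol] at h
  exact ⟨_, h⟩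

/-- The strong limit of `Tⁿ(σⁿ(x) σⁿ(y))`. -/
noncomputable def preProd (x y : boundary T) : A := (hT.exists_polyTendsto x y).choose

theorem polyTendsto_approx (x y : boundary T) :
    PolyTendsto T (fun n => hT.approx n x y) (hT.preProd x y) :=
  (hT.exists_polyTendsto x y).choose_spec

theorem preProd_eq {x y : boundary T} {b : A} (h : SOTTendsto (fun n => hT.approx n x y) b) :
    hT.preProd x y = b :=
  (hT.polyTendsto_approx x y).sot.unique h

theorem norm_preProd_le (x y : boundary T) : ‖hT.preProd x y‖ ≤ ‖x‖ * ‖y‖ :=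
  (hT.polyTendsto_approx x y).sot.norm_le fun n => hT.norm_approx_le n x y

/-- The Choi–Effros product as a bounded bilinear map with values in `A`. -/
noncomputable def preProdL : boundary T →L[ℂ] boundary T →L[ℂ] A :=
  LinearMap.mkContinuous₂ (LinearMap.mk₂ ℂ hT.preProd
    (fun x x' y => hT.preProd_eq <| by
      simpa only [approx_add_left] using
        (hT.polyTendsto_approx x y).sot.add (hT.polyTendsto_approx x' y).sot)
    (fun c x y => hT.preProd_eq <| by
      simpa only [approx_smul_left] using (hT.polyTendsto_approx x y).sot.smul c)
    (fun x y y' => hT.preProd_eq <| by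
      simpa only [approx_add_right] using
        (hT.polyTendsto_approx x y).sot.add (hT.polyTendsto_approx x y').sot)
    (fun c x y => hT.preProd_eq <| by
      simpa only [approx_smul_right] using (hT.polyTendsto_approx x y).sot.smul c)) 1
    fun x y => by
      rw [one_mul]
      exact hT.norm_preProd_le x y

theorem preProdL_apply (x y : boundary T) : hT.preProdL x y = hT.preProd x y := rfl

/-- Shifting the approximating sequence by `n` does not change its limit. Thus `T` is multiplicative
for the product, which locates products of eigenvectors and lets `back` commute with it. -/
theorem pow_preProd_back (n : ℕ) (x y : boundary T) :
    (T ^ n) (hT.preProd (back hT.norm_map_le n x) (back hT.norm_map_le n y)) =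
      hT.preProd x y := by
  refine ((hT.polyTendsto_approx (back hT.norm_map_le n x) (back hT.norm_map_le n y)).pow n).unique ?_
  simp only [pow_approx_back]
  simpa only [add_comm n] using (hT.polyTendsto_approx x y).sot.comp_add n

theorem preProd_mem_eigenspace {lam mu : Circle} {x y : boundary T}
    (hx : (x : A) ∈ eigenspace T lam) (hy : (y : A) ∈ eigenspace T mu) :
    hT.preProd x y ∈ eigenspace T (lam * mu) := by
  rw [mem_eigenspace_iff]
  have h := hT.pow_preProd_back 1 x y
  rw [back_of_mem_eigenspace _ hx, back_of_mem_eigenspace _ hy, ← preProdL_apply] at h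
  simp only [map_smul, smul_apply, smul_smul, pow_one, preProdL_apply] at h
  have h1 : ((lam * mu : Circle) : ℂ) * ((mu : ℂ)⁻¹ * (lam : ℂ)⁻¹) = 1 := by
    rw [Circle.coe_mul]
    field_simp [lam.coe_ne_zero, mu.coe_ne_zero]
  rw [← one_smul ℂ (T (hT.preProd x y)), ← h1, mul_smul, h]

/-- The product of two eigenvectors is an eigenvector for the product of the eigenvalues; continuity
in each variable separately does the rest. -/
theorem preProd_mem (x y : boundary T) : hT.preProd x y ∈ boundary T := by
  have hcl : IsClosed (boundary T : Set A) := Submodule.isClosed_topologicalClosure _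
  refine map_mem_of_eigenvectors (hT.preProdL.flip y) (boundary T) hcl (fun lam x hx => ?_) x
  refine map_mem_of_eigenvectors (hT.preProdL x) (boundary T) hcl (fun mu y hy => ?_) y
  exact mem_boundary_of_mem_eigenspace (hT.preProd_mem_eigenspace hx hy)

/-- Multiplication by a fixed element of `P(T)` from the left. -/
noncomputable def prodLeft (x : boundary T) : boundary T →L[ℂ] boundary T :=
  (hT.preProdL x).codRestrict (boundary T) (hT.preProd_mem x)

theorem coe_prodLeft (x y : boundary T) : (hT.prodLeft x y : A) = hT.preProd x y := rfl

theorem norm_prodLeft_le (x : boundary T) : ‖hT.prodLeft x‖ ≤ 1 * ‖x‖ := by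
  rw [one_mul]
  refine ContinuousLinearMap.opNorm_le_bound _ (norm_nonneg x) fun y => ?_
  rw [Submodule.coe_norm, coe_prodLeft]
  exact hT.norm_preProd_le x y

/-- The extended Choi–Effros product. -/
noncomputable def prod : boundary T →L[ℂ] boundary T →L[ℂ] boundary T :=
  LinearMap.mkContinuous
    { toFun := hT.prodLeft
      map_add' := fun x x' => ContinuousLinearMap.ext fun y => Subtype.ext <| by
        change hT.preProdL (x + x') y = hT.preProdL x y + hT.preProdL x' y
        rw [map_add]; rfl
      map_smul' := fun c x => ContinuousLinearMap.ext fun y => Subtype.ext <| by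
        change hT.preProdL (c • x) y = c • hT.preProdL x y
        rw [map_smul]; rfl } 1 hT.norm_prodLeft_le

theorem coe_prod (x y : boundary T) : (hT.prod x y : A) = hT.preProd x y := rfl

theorem polyTendsto_prod (x y : boundary T) :
    PolyTendsto T (fun n => hT.approx n x y) (hT.prod x y) :=
  hT.polyTendsto_approx x y

theorem back_prod (n : ℕ) (x y : boundary T) : back hT.norm_map_le n (hT.prod x y) =
    hT.prod (back hT.norm_map_le n x) (back hT.norm_map_le n y) :=
  back_eq_of_pow _ (hT.pow_preProd_back n x y)

theorem norm_prod_le (x y : boundary T) : ‖hT.prod x y‖ ≤ ‖x‖ * ‖y‖ := by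
  rw [Submodule.coe_norm, coe_prod]
  exact hT.norm_preProd_le x y

theorem isChoiEffrosProduct_prod : IsChoiEffrosProduct T hT.prod := by
  intro lam mu x y hx hy
  convert (hT.polyTendsto_prod x y).sot using 2 with n
  simp only [approx]
  rw [back_of_mem_eigenspace _ hx, back_of_mem_eigenspace _ hy, ← Module.End.pow_apply]
  simp only [Submodule.coe_smul, smul_mul_assoc, mul_smul_comm, smul_smul, map_smul]
  rw [mul_inv, mul_comm]

theorem eq_of_isChoiEffrosProduct {m m' : boundary T →L[ℂ] boundary T →L[ℂ] boundary T}
    (h : IsChoiEffrosProduct T m) (h' : IsChoiEffrosProduct T m') : m = m' := by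
  refine eq_of_eigenvectors (X := boundary T →L[ℂ] boundary T) fun lam x hx =>
    eq_of_eigenvectors (X := boundary T) fun mu y hy => ?_
  exact Subtype.ext ((h lam mu x y hx hy).unique (h' lam mu x y hx hy))

end IsNormalSchwarz
end Product

/-! ### Associativity and the C*-identity. -/

section Algebra

open scoped ComplexOrder

variable {H : Type*} [NormedAddCommGroup H] [InnerProductSpace ℂ H] [CompleteSpace H]
  {A : VonNeumannAlgebra H} {T : A →ₗ[ℂ] A}

namespace IsNormalSchwarz

variable (hT : IsNormalSchwarz T)

/-- The defect of multiplicativity of `Tᵐ`, pushed forward by `Tⁿ`. -/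
noncomputable def defect (T : A →ₗ[ℂ] A) (n m : ℕ) (a b : A) : A :=
  (T ^ n) ((T ^ m) (star a * b) - star ((T ^ m) a) * (T ^ m) b)

include hT in
theorem defect_self_nonneg (n m : ℕ) (a : A) : 0 ≤ defect T n m a a := by
  have := hT.monotone_pow n (sub_nonneg.2 (hT.schwarz_pow m a))
  rwa [map_zero] at this

include hT in
theorem star_defect (n m : ℕ) (a b : A) : star (defect T n m b a) = defect T n m a b := by
  simp [defect, ← hT.pow_star]

/-- The Cauchy–Schwarz inequality for the defect of multiplicativity. -/
theorem norm_vecForm_defect_sq_le (hT : IsNormalSchwarz T) (n m : ℕ) (a b : A) (h : H) :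
    ‖vecForm h (defect T n m a b)‖ ^ 2 ≤
      (vecForm h (defect T n m a a)).re * (vecForm h (defect T n m b b)).re := by
  -- By the Schwarz inequality for `Tᵐ` and positivity of `Tⁿ`, the defect tested on `h` is a
  -- semi-inner product.
  let c : PreInnerProductSpace.Core ℂ A :=
    { inner := fun a b => vecForm h (defect T n m a b)
      conj_inner_symm := fun a b => by
        rw [← hT.star_defect n m a b, vecForm_star]; rfl
      re_inner_nonneg := fun a =>
        (Complex.le_def.1 (nonneg_iff_vecForm.1 (hT.defect_self_nonneg n m a) h)).1
      add_left := fun a b d => by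
        simp only [defect, star_add, add_mul, map_add, map_sub]; ring
      smul_left := fun a b r => by
        simp only [defect, star_smul, smul_mul_assoc, map_smul, map_sub, smul_eq_mul,
          starRingEnd_apply]
        ring }
  have h1 := @InnerProductSpace.Core.inner_mul_inner_self_le ℂ A _ _ _ c a b
  have h2 : ‖vecForm h (defect T n m b a)‖ = ‖vecForm h (defect T n m a b)‖ := by
    rw [← hT.star_defect n m a b, vecForm_star, norm_star]
  rw [pow_two]
  nth_rewrite 2 [← h2]
  exact h1

theorem re_vecForm_defect_self_le (hT : IsNormalSchwarz T) (n m : ℕ) (b : A) (h : H) :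
    (vecForm h (defect T n m b b)).re ≤ ‖b‖ ^ 2 * ‖h‖ ^ 2 := by
  have h1 : defect T n m b b ≤ (T ^ n) ((T ^ m) (star b * b)) := by
    refine hT.monotone_pow n ?_
    exact sub_le_self _ (star_mul_self_nonneg _)
  refine (Complex.le_def.1 (le_iff_vecForm.1 h1 h)).1.trans
    ((Complex.re_le_norm _).trans ((norm_vecForm_le _ _).trans ?_))
  gcongr
  refine (norm_pow_apply_le hT.norm_map_le _ _).trans
    ((norm_pow_apply_le hT.norm_map_le _ _).trans ?_)
  rw [CStarRing.norm_star_mul_self, pow_two]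

/-- The defect at `σⁿ⁺ᵐ(x)*` telescopes to the difference of the approximants of index `n + m` and
`n`, at most the tail after `n`. The bound is uniform in `m`, as the diagonal argument requires. -/
theorem re_vecForm_defect_back_le (n m : ℕ) (x : boundary T) (h : H) :
    (vecForm h (defect T n m (star (back hT.norm_map_le (n + m) x : A))
      (star (back hT.norm_map_le (n + m) x : A)))).re ≤
    (vecForm h ((hT.prod x (hT.bstar x) : A) - hT.approx n x (hT.bstar x))).re := by
  have h1 : defect T n m (star (back hT.norm_map_le (n + m) x : A))
      (star (back hT.norm_map_le (n + m) x : A)) =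
      hT.approx (n + m) x (hT.bstar x) - hT.approx n x (hT.bstar x) := by
    rw [defect, map_sub, star_star, hT.pow_star, star_star, add_comm n m, pow_back, approx, approx,
      back_bstar, back_bstar, add_comm m n, pow_add, Module.End.mul_apply]
    rfl
  rw [h1]
  have h2 := hT.monotone_approx (hT.bstar x)
  rw [bstar_bstar] at h2
  have h3 := (hT.polyTendsto_prod x (hT.bstar x)).sot.le_of_monotone h2 (n + m)
  exact (Complex.le_def.1 (le_iff_vecForm.1 (sub_le_sub_right h3 _) h)).1

/-- A diagonal limit criterion. -/
theorem tendsto_of_approx {t v : ℕ → ℂ} {u : ℕ → ℕ → ℂ} {l : ℂ} {ε : ℕ → ℝ} {C : ℝ}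
    (hε : Tendsto ε atTop (𝓝 0)) (hv : Tendsto v atTop (𝓝 l))
    (hu : ∀ n, Tendsto (u n) atTop (𝓝 (v n)))
    (htu : ∀ n m, ‖t (n + m) - u n m‖ ^ 2 ≤ ε n * C) : Tendsto t atTop (𝓝 l) := by
  rw [Metric.tendsto_atTop]
  intro δ hδ
  have h1 : ∀ᶠ n in atTop, ε n * C < (δ / 3) ^ 2 := by
    have : Tendsto (fun n => ε n * C) atTop (𝓝 0) := by simpa using hε.mul_const C
    exact this.eventually_lt_const (by positivity)
  obtain ⟨n, hn1, hn2⟩ := (h1.and (Metric.tendsto_nhds.1 hv (δ / 3) (by positivity))).exists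
  obtain ⟨M, hM⟩ := Metric.tendsto_atTop.1 (hu n) (δ / 3) (by positivity)
  refine ⟨n + M, fun k hk => ?_⟩
  obtain ⟨m, rfl⟩ := Nat.exists_eq_add_of_le (le_of_add_le_left hk)
  have h2 : dist (t (n + m)) (u n m) < δ / 3 := by
    rw [dist_eq_norm]
    exact lt_of_pow_lt_pow_left₀ 2 (by positivity) ((htu n m).trans_lt hn1)
  have h3 := hM m (by omega)
  calc dist (t (n + m)) l ≤ dist (t (n + m)) (u n m) + dist (u n m) (v n) + dist (v n) l :=
        dist_triangle4 _ _ _ _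
    _ < δ := by linarith

/-- Computation of a Choi–Effros product along a bounded sequence `b` with `Tᵏ(bₖ) → w`. -/
theorem tendsto_vecForm_pow_mul (x w : boundary T) {b : ℕ → A} {C : ℝ} (hb : ∀ k, ‖b k‖ ≤ C)
    (hw : ∀ n, PolyTendsto T (fun m => (T ^ m) (b (n + m))) (back hT.norm_map_le n w)) (h : H) :
    Tendsto (fun k => vecForm h ((T ^ k) ((back hT.norm_map_le k x : A) * b k))) atTop
      (𝓝 (vecForm h (hT.prod x w : A))) := by
  have hC : 0 ≤ C := (norm_nonneg _).trans (hb 0)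
  refine tendsto_of_approx (C := C ^ 2 * ‖h‖ ^ 2)
    (ε := fun n => (vecForm h ((hT.prod x (hT.bstar x) : A) - hT.approx n x (hT.bstar x))).re)
    (v := fun n => vecForm h ((T ^ n)
      ((back hT.norm_map_le n x : A) * (back hT.norm_map_le n w : A))))
    (u := fun n m => vecForm h ((T ^ n) ((back hT.norm_map_le n x : A) * (T ^ m) (b (n + m)))))
    ?_ ?_ ?_ ?_
  · have h1 := (hT.polyTendsto_prod x (hT.bstar x)).sot.vecForm h
    have h2 := (Complex.continuous_re.tendsto _).comp ((tendsto_const_nhds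
      (x := vecForm h (hT.prod x (hT.bstar x) : A))).sub h1)
    simpa [Function.comp_def] using h2
  · exact (hT.polyTendsto_prod x w).sot.vecForm h
  · intro n
    simpa using (hw n n (back hT.norm_map_le n x) 1).vecForm h
  · intro n m
    have h1 := hT.norm_vecForm_defect_sq_le n m (star (back hT.norm_map_le (n + m) x : A))
      (b (n + m)) h
    -- Because `Tᵐ(σⁿ⁺ᵐ(x)) = σⁿ(x)`, replacing `Tⁿ⁺ᵐ` of the product by `Tⁿ` of a product of images
    -- costs exactly one defect.
    have h2 : vecForm h (defect T n m (star (back hT.norm_map_le (n + m) x : A)) (b (n + m))) =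
        vecForm h ((T ^ (n + m)) ((back hT.norm_map_le (n + m) x : A) * b (n + m))) -
        vecForm h ((T ^ n) ((back hT.norm_map_le n x : A) * (T ^ m) (b (n + m)))) := by
      rw [← map_sub, defect, map_sub, star_star, hT.pow_star, star_star, pow_add,
        Module.End.mul_apply, add_comm n m, pow_back]
    rw [← h2]
    have h0 : 0 ≤ (vecForm h (defect T n m (b (n + m)) (b (n + m)))).re :=
      (Complex.le_def.1 (nonneg_iff_vecForm.1 (hT.defect_self_nonneg n m _) h)).1
    have h0' : 0 ≤ (vecForm h (defect T n m (star (back hT.norm_map_le (n + m) x : A))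
      (star (back hT.norm_map_le (n + m) x : A)))).re :=
      (Complex.le_def.1 (nonneg_iff_vecForm.1 (hT.defect_self_nonneg n m _) h)).1
    have h3 := hT.re_vecForm_defect_back_le n m x h
    refine h1.trans (mul_le_mul h3 ?_ h0 (h0'.trans h3))
    refine (hT.re_vecForm_defect_self_le n m _ h).trans ?_
    gcongr
    exact hb _

/-- Here `bₖ = σᵏ(y) σᵏ(z)`: applying `Tᵐ` to `bₙ₊ₘ` gives the approximants of `σⁿ(y) ∘ σⁿ(z) = σⁿ(y
∘ z)`. -/
theorem tendsto_triple (x y z : boundary T) (h : H) :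
    Tendsto (fun k => vecForm h ((T ^ k) ((back hT.norm_map_le k x : A) *
      ((back hT.norm_map_le k y : A) * (back hT.norm_map_le k z : A))))) atTop
      (𝓝 (vecForm h (hT.prod x (hT.prod y z) : A))) := by
  refine hT.tendsto_vecForm_pow_mul x (hT.prod y z) (C := ‖y‖ * ‖z‖) (fun k => ?_)
    (fun n => ?_) h
  · refine (norm_mul_le _ _).trans ?_
    rw [← norm_back hT.norm_map_le k y, ← norm_back hT.norm_map_le k z]
    rfl
  · rw [back_prod]
    convert hT.polyTendsto_prod (back hT.norm_map_le n y) (back hT.norm_map_le n z) using 2 with m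
    rw [approx, ← back_add, ← back_add, add_comm m n]

theorem bstar_prod (x y : boundary T) :
    hT.bstar (hT.prod x y) = hT.prod (hT.bstar y) (hT.bstar x) := by
  refine Subtype.ext (ext_vecForm fun h => ?_)
  refine tendsto_nhds_unique ?_ ((hT.polyTendsto_prod (hT.bstar y) (hT.bstar x)).sot.vecForm h)
  simp only [← star_approx, vecForm_star, coe_bstar]
  exact ((hT.polyTendsto_prod x y).sot.vecForm h).star

/-- The triple products `σᵏ(x) σᵏ(y) σᵏ(z)` have no bracketing. Their limit gives `x ∘ (y ∘ z)`
directly and, through the involution, also `(x ∘ y) ∘ z`. -/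
theorem prod_assoc (x y z : boundary T) :
    hT.prod (hT.prod x y) z = hT.prod x (hT.prod y z) := by
  have hst : hT.prod (hT.prod x y) z =
      hT.bstar (hT.prod (hT.bstar z) (hT.prod (hT.bstar y) (hT.bstar x))) := by
    simp [bstar_prod]
  rw [hst]
  refine Subtype.ext (ext_vecForm fun h => ?_)
  refine tendsto_nhds_unique ?_ (hT.tendsto_triple x y z h)
  have h1 := (hT.tendsto_triple (hT.bstar z) (hT.bstar y) (hT.bstar x) h).star
  simpa [back_bstar, ← vecForm_star, ← hT.pow_star, mul_assoc] using h1

theorem norm_prod_bstar_self (x : boundary T) : ‖hT.prod (hT.bstar x) x‖ = ‖x‖ ^ 2 := by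
  refine le_antisymm ?_ ?_
  · simpa [pow_two] using hT.norm_prod_le (hT.bstar x) x
  -- The term of index `0` is `x* x`, so `x* x ≤ x* ∘ x`.
  · have h1 := (hT.polyTendsto_prod (hT.bstar x) x).sot.le_of_monotone (hT.monotone_approx x) 0
    have h2 : hT.approx 0 (hT.bstar x) x = star (x : A) * x := rfl
    rw [h2] at h1
    have h3 := CStarAlgebra.norm_le_norm_of_nonneg_of_le (star_mul_self_nonneg (x : A)) h1
    rwa [CStarRing.norm_star_mul_self, ← pow_two] at h3

theorem isCStarAlgebra : IsCStarAlgebra (boundary T) hT.prod where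
  isClosed := Submodule.isClosed_topologicalClosure _
  star_mem _ hx := star_mem_boundary hT.map_star hx
  mul_assoc := hT.prod_assoc
  star_mul x y := congrArg Subtype.val (hT.bstar_prod x y)
  norm_mul_le := hT.norm_prod_le
  norm_star_mul_self := hT.norm_prod_bstar_self

end IsNormalSchwarz
end Algebra

/-! ### The limit of `Tⁿ(1)`: unit and maximal Perron–Frobenius eigenvector. -/

section Unit

open scoped ComplexOrder

variable {H : Type*} [NormedAddCommGroup H] [InnerProductSpace ℂ H] [CompleteSpace H]
  {A : VonNeumannAlgebra H} {T : A →ₗ[ℂ] A}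

namespace IsNormalSchwarz

variable (hT : IsNormalSchwarz T)
include hT

theorem pow_nonneg_of_nonneg (n : ℕ) {a : A} (ha : 0 ≤ a) : 0 ≤ (T ^ n) a := by
  simpa using hT.monotone_pow n ha

theorem norm_pow_one_le (n : ℕ) : ‖(T ^ n) (1 : A)‖ ≤ 1 :=
  (norm_pow_apply_le hT.norm_map_le n 1).trans
    ((CStarAlgebra.norm_le_one_iff_of_nonneg (1 : A) zero_le_one).2 le_rfl)

theorem exists_polyTendsto_pow_one : ∃ q, PolyTendsto T (fun n => (T ^ n) 1) q := by
  -- `Tⁿ(1)` decreases because `T(1) ≤ 1`; the sign change reduces to increasing sequences.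
  have hmono : Monotone fun n => (-1 : ℂ) • (T ^ n) (1 : A) := by
    refine monotone_nat_of_le_succ fun n => ?_
    rw [neg_one_smul, neg_one_smul, neg_le_neg_iff, pow_succ, Module.End.mul_apply]
    refine hT.monotone_pow n ((CStarAlgebra.norm_le_one_iff_of_nonneg _ ?_).1 ?_)
    · simpa using hT.pow_nonneg_of_nonneg 1 zero_le_one
    · simpa using hT.norm_pow_one_le 1
  have hb : ∀ n, ‖(-1 : ℂ) • (T ^ n) (1 : A)‖ ≤ 1 := fun n => by
    rw [neg_one_smul, norm_neg]; exact hT.norm_pow_one_le n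
  obtain ⟨b, h⟩ := exists_sotTendsto_of_monotone hmono hb
  have h1 := (hT.polyTendsto_of_monotone hmono hb h).smul (-1)
  simp only [smul_smul, mul_neg, mul_one, neg_neg, one_smul] at h1
  exact ⟨_, h1⟩

variable {q : A} (hq : PolyTendsto T (fun n => (T ^ n) 1) q)
include hq

omit hT in
theorem map_limit_one : T q = q := by
  refine (hq.pow 1).unique ?_
  have := hq.sot.comp_add 1
  simpa [pow_succ', pow_one] using this

omit hT in
theorem limit_one_mem : q ∈ boundary T :=
  mem_boundary_of_mem_eigenspace (lam := 1)
    (mem_eigenspace_iff.2 (by simpa using map_limit_one hq))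

theorem limit_one_nonneg : 0 ≤ q :=
  hq.sot.ge_of_forall_ge fun n => hT.pow_nonneg_of_nonneg n zero_le_one

/-- With the constant sequence `bₖ = 1`, which satisfies `Tᵐ(1) → q = σⁿ(q)`, the sequence defining
`x ∘ q` is `Tᵏ(σᵏ(x)) = x`. The involution gives the other side. -/
theorem isUnitFor_limit_one : IsUnitFor hT.prod ⟨q, limit_one_mem hq⟩ := by
  set e : boundary T := ⟨q, limit_one_mem hq⟩ with he
  have hpow : ∀ n, (T ^ n) q = q := by
    intro n
    induction n with
    | zero => rfl
    | succ n ih => rw [pow_succ, Module.End.mul_apply, map_limit_one hq, ih]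
  have hr : ∀ x, hT.prod x e = x := by
    intro x
    refine Subtype.ext (ext_vecForm fun h => ?_)
    refine tendsto_nhds_unique (hT.tendsto_vecForm_pow_mul x e (b := fun _ => 1) (C := 1)
      (fun _ => hT.norm_pow_one_le 0) (fun n => ?_) h) ?_
    · rwa [back_eq_of_pow hT.norm_map_le (n := n) (x := e) (y := e) (hpow n)]
    · simp only [mul_one, pow_back_self]
      exact tendsto_const_nhds
  have hse : hT.bstar e = e := Subtype.ext (hT.limit_one_nonneg hq).isSelfAdjoint
  refine fun x => ⟨?_, hr x⟩
  rw [← hT.bstar_bstar (hT.prod e x), bstar_prod, hse, hr, bstar_bstar]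

theorem le_limit_one {y : A} (h0 : 0 ≤ y) (h1 : ‖y‖ ≤ 1) (hy : T y = y) : y ≤ q := by
  have hpow : ∀ n, (T ^ n) y = y := by
    intro n
    induction n with
    | zero => rfl
    | succ n ih => rw [pow_succ, Module.End.mul_apply, hy, ih]
  refine hq.sot.ge_of_forall_ge fun n => ?_
  rw [← hpow n]
  exact hT.monotone_pow n ((CStarAlgebra.norm_le_one_iff_of_nonneg y h0).1 h1)

/-- The normalization of `q` is a positive fixed point of norm one, hence lies below `q`; this
forces `‖q‖ ≥ 1`. -/
theorem norm_limit_one (hq0 : q ≠ 0) : ‖q‖ = 1 := by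
  refine le_antisymm (hq.sot.norm_le hT.norm_pow_one_le) ?_
  have hpos : 0 < ‖q‖ := norm_pos_iff.2 hq0
  have hn : ‖((‖q‖⁻¹ : ℝ) : ℂ) • q‖ = 1 := by
    rw [norm_smul, Complex.norm_real, norm_inv, norm_norm, inv_mul_cancel₀ hpos.ne']
  have h0 : 0 ≤ ((‖q‖⁻¹ : ℝ) : ℂ) • q := by
    rw [nonneg_iff_vecForm]
    intro h
    rw [map_smul, smul_eq_mul]
    exact mul_nonneg (Complex.zero_le_real.2 (inv_nonneg.2 (norm_nonneg q)))
      (nonneg_iff_vecForm.1 (hT.limit_one_nonneg hq) h)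
  have h1 := hT.le_limit_one hq h0 hn.le (by rw [map_smul, map_limit_one hq])
  rw [← hn]
  exact CStarAlgebra.norm_le_norm_of_nonneg_of_le h0 h1

/-- Contractivity bounds the radius by one, and the fixed vector `q` puts `1` in the spectrum. -/
theorem spectralRadius_eq_one (hq0 : q ≠ 0) :
    spectralRadius ℂ (contraction T hT.norm_map_le) = 1 := by
  have : Nontrivial A := ⟨q, 0, hq0⟩
  refine le_antisymm ?_ ?_
  · refine (spectrum.spectralRadius_le_nnnorm _).trans ?_
    have h1 : ‖contraction T hT.norm_map_le‖ ≤ 1 :=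
      LinearMap.mkContinuous_norm_le _ zero_le_one _
    exact_mod_cast h1
  · have h1 : (1 : ℂ) ∈ spectrum ℂ (contraction T hT.norm_map_le) := by
      rw [spectrum.mem_iff]
      rintro ⟨u, hu⟩
      have h2 : (u : A →L[ℂ] A) q = 0 := by
        rw [hu, map_one]
        change q - T q = 0
        rw [map_limit_one hq, sub_self]
      have h3 : ((u⁻¹ : (A →L[ℂ] A)ˣ) : A →L[ℂ] A) ((u : A →L[ℂ] A) q) = q :=
        DFunLike.congr_fun u.inv_mul q
      rw [h2, map_zero] at h3
      exact hq0 h3.symm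
    have h4 := le_iSup₂ (f := fun (k : ℂ) (_ : k ∈ spectrum ℂ (contraction T hT.norm_map_le)) =>
      (‖k‖₊ : ENNReal)) 1 h1
    rw [nnnorm_one, ENNReal.coe_one] at h4
    exact h4

theorem isMaximalPerronFrobenius_limit_one (hq0 : q ≠ 0) :
    IsMaximalPerronFrobenius (contraction T hT.norm_map_le) q := by
  have hr := hT.spectralRadius_eq_one hq hq0
  constructor
  · refine ⟨hT.limit_one_nonneg hq, hT.norm_limit_one hq hq0, ?_⟩
    rw [hr, ENNReal.toReal_one, Complex.ofReal_one, one_smul]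
    exact map_limit_one hq
  · rintro y ⟨h0, h1, h2⟩
    rw [hr, ENNReal.toReal_one, Complex.ofReal_one, one_smul] at h2
    exact hT.le_limit_one hq h0 h1.le h2

end IsNormalSchwarz
end Unit

/-! ### Weak limits of bounded sequences. -/

section WeakLimit

variable {K : Type*} [NormedAddCommGroup K] [InnerProductSpace ℂ K] [CompleteSpace K]
  {B : VonNeumannAlgebra K}

/-- A bounded sequence in a von Neumann algebra has a limit along an ultrafilter in the weak
operator topology. -/
theorem exists_tendsto_inner_ultrafilter (U : Ultrafilter ℕ) {z : ℕ → B} {C : ℝ}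
    (hz : ∀ n, ‖z n‖ ≤ C) : ∃ X : B, ‖X‖ ≤ C ∧ ∀ k k' : K,
      Tendsto (fun n => inner ℂ k ((z n : K →L[ℂ] K) k')) U
        (𝓝 (inner ℂ k ((X : K →L[ℂ] K) k'))) := by
  have hC : 0 ≤ C := (norm_nonneg _).trans (hz 0)
  have hb : ∀ (k k' : K) (n : ℕ), ‖inner ℂ k ((z n : K →L[ℂ] K) k')‖ ≤ C * ‖k‖ * ‖k'‖ := by
    intro k k' n
    refine (norm_inner_le_norm _ _).trans ?_
    calc _ ≤ ‖k‖ * (‖(z n : K →L[ℂ] K)‖ * ‖k'‖) := by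
          gcongr; exact (z n : K →L[ℂ] K).le_opNorm k'
      _ ≤ ‖k‖ * (C * ‖k'‖) := by gcongr; exact hz n
      _ = _ := by ring
  have hex : ∀ k k' : K, ∃ c : ℂ, Tendsto (fun n => inner ℂ k ((z n : K →L[ℂ] K) k')) U (𝓝 c) := by
    intro k k'
    obtain ⟨c, -, hc⟩ := (isCompact_closedBall (0 : ℂ) (C * ‖k‖ * ‖k'‖)).ultrafilter_le_nhds
      (U.map fun n => inner ℂ k ((z n : K →L[ℂ] K) k'))
      (by
        rw [Ultrafilter.coe_map, le_principal_iff]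
        exact Filter.mem_map.2 (Eventually.of_forall fun n => by simpa using hb k k' n))
    exact ⟨c, hc⟩
  choose g hg using hex
  have hgb : ∀ k k', ‖g k k'‖ ≤ C * ‖k‖ * ‖k'‖ := fun k k' =>
    le_of_tendsto (hg k k').norm (Eventually.of_forall (hb k k'))
  let G : K →L⋆[ℂ] K →L[ℂ] ℂ := LinearMap.mkContinuous₂
    (LinearMap.mk₂'ₛₗ (starRingEnd ℂ) (RingHom.id ℂ) g
      (fun k l k' => tendsto_nhds_unique (hg _ _) (by
        simpa only [inner_add_left] using (hg k k').add (hg l k')))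
      (fun c k k' => tendsto_nhds_unique (hg _ _) (by
        simpa only [inner_smul_left, smul_eq_mul] using (hg k k').const_mul _))
      (fun k k' l => tendsto_nhds_unique (hg _ _) (by
        simpa only [map_add, inner_add_right] using (hg k k').add (hg k l)))
      (fun c k k' => tendsto_nhds_unique (hg _ _) (by
        simpa only [map_smul, inner_smul_right, smul_eq_mul, RingHom.id_apply] using (hg k k').const_mul _))) C hgb
  -- The representing operator of `G` sits in the first slot of the inner product; the adjoint moves
  -- it to the second.
  let X : K →L[ℂ] K :=
    ContinuousLinearMap.adjoint (InnerProductSpace.continuousLinearMapOfBilin G)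
  have hX : ∀ k k', inner ℂ k (X k') = g k k' := fun k k' => by
    rw [ContinuousLinearMap.adjoint_inner_right,
      InnerProductSpace.continuousLinearMapOfBilin_apply]
    rfl
  have hmem : X ∈ B := by
    rw [← B.commutant_commutant, VonNeumannAlgebra.mem_commutant_iff]
    intro y hy
    ext k
    refine ext_inner_left ℂ fun v => ?_
    have h1 := hg (ContinuousLinearMap.adjoint y v) k
    rw [← hX, ContinuousLinearMap.adjoint_inner_left] at h1
    have h2 := hg v (y k)
    rw [← hX] at h2
    refine tendsto_nhds_unique h1 (h2.congr fun n => ?_)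
    rw [ContinuousLinearMap.adjoint_inner_left]
    exact congrArg (inner ℂ v)
      (DFunLike.congr_fun (VonNeumannAlgebra.mem_commutant_iff.1 hy _ (z n).2) k)
  refine ⟨⟨X, hmem⟩, ?_, fun k k' => ?_⟩
  · refine ContinuousLinearMap.opNorm_le_bound _ hC fun k => ?_
    change ‖X k‖ ≤ C * ‖k‖
    have h1 := hgb (X k) k
    rw [← hX, inner_self_eq_norm_sq_to_K, norm_pow] at h1
    simp only [Complex.coe_algebraMap, Complex.norm_real, norm_norm] at h1
    rcases (norm_nonneg (X k)).eq_or_lt with h0 | h0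
    · rw [← h0]; positivity
    · refine le_of_mul_le_mul_right ?_ h0
      linarith [pow_two ‖X k‖, mul_right_comm C ‖X k‖ ‖k‖]
  · change Tendsto _ _ (𝓝 (inner ℂ k (X k')))
    rw [hX]
    exact hg k k'

omit [CompleteSpace K] in
/-- For bounded sequences of operators, strong convergence to zero holds on a closed subspace. -/
theorem isClosed_tendsto_zero {E : ℕ → K →L[ℂ] K} {C : ℝ} (hE : ∀ n, ‖E n‖ ≤ C) :
    IsClosed {k : K | Tendsto (fun n => E n k) atTop (𝓝 0)} := by
  have hC : 0 ≤ C := (norm_nonneg _).trans (hE 0)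
  refine isClosed_of_closure_subset fun k hk => ?_
  rw [Set.mem_ofPred_eq, Metric.tendsto_atTop]
  intro ε hε
  obtain ⟨l, hl, hkl⟩ := Metric.mem_closure_iff.1 hk (ε / (2 * (C + 1))) (by positivity)
  obtain ⟨N, hN⟩ := Metric.tendsto_atTop.1 hl (ε / 2) (by positivity)
  refine ⟨N, fun n hn => ?_⟩
  have h1 := hN n hn
  rw [dist_zero_right] at h1 ⊢
  rw [dist_eq_norm, lt_div_iff₀ (by positivity)] at hkl
  have h2 : ‖E n (k - l)‖ ≤ C * ‖k - l‖ :=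
    ((E n).le_opNorm _).trans (by gcongr; exact hE n)
  have h3 : E n k = E n (k - l) + E n l := by rw [← map_add, sub_add_cancel]
  rw [h3]
  refine (norm_add_le _ _).trans_lt ?_
  nlinarith [norm_nonneg (k - l)]

end WeakLimit

/-! ### Corner embedding, compression and generating vectors of a dilation. -/

section Dilation

variable {H : Type*} [NormedAddCommGroup H] [InnerProductSpace ℂ H] [CompleteSpace H]
  {K : Type*} [NormedAddCommGroup K] [InnerProductSpace ℂ K] [CompleteSpace K]
  {A : VonNeumannAlgebra H} {T : A →ₗ[ℂ] A} {B : VonNeumannAlgebra K}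

namespace MinimalDilation

variable (D : MinimalDilation T B)

theorem adjoint_V_apply (h : H) :
    ContinuousLinearMap.adjoint D.V.toContinuousLinearMap (D.V h) = h := by
  refine ext_inner_left ℂ fun v => ?_
  rw [ContinuousLinearMap.adjoint_inner_right]
  exact D.V.inner_map_map v h

/-- The compression `B → A`. -/
noncomputable def comp : B →ₗ[ℂ] A where
  toFun z := ⟨compress D.V z, D.compress_mem z⟩
  map_add' z w := Subtype.ext <| ContinuousLinearMap.ext fun h => by
    simp [compress]
  map_smul' c z := Subtype.ext <| ContinuousLinearMap.ext fun h => by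
    change ContinuousLinearMap.adjoint D.V.toContinuousLinearMap (c • (z : K →L[ℂ] K) (D.V h)) = _
    rw [map_smul]; rfl

/-- The embedding `A → B` of `A` as a corner. -/
noncomputable def cor : A →ₗ[ℂ] B where
  toFun x := ⟨corner D.V x, D.corner_mem x⟩
  map_add' z w := Subtype.ext <| ContinuousLinearMap.ext fun h => by
    simp [corner]
  map_smul' c z := Subtype.ext <| ContinuousLinearMap.ext fun h => by
    change D.V (c • (z : H →L[ℂ] H) _) = _
    rw [map_smul]; rfl

theorem comp_apply (z : B) (h : H) : (D.comp z : H →L[ℂ] H) h =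
    ContinuousLinearMap.adjoint D.V.toContinuousLinearMap ((z : K →L[ℂ] K) (D.V h)) := rfl

theorem cor_apply (x : A) (k : K) : (D.cor x : K →L[ℂ] K) k =
    D.V ((x : H →L[ℂ] H) (ContinuousLinearMap.adjoint D.V.toContinuousLinearMap k)) := rfl

theorem cor_apply_V (x : A) (h : H) :
    (D.cor x : K →L[ℂ] K) (D.V h) = D.V ((x : H →L[ℂ] H) h) := by
  rw [cor_apply, adjoint_V_apply]

theorem comp_cor (x : A) : D.comp (D.cor x) = x :=
  Subtype.ext <| ContinuousLinearMap.ext fun h => by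
    rw [comp_apply, cor_apply_V, adjoint_V_apply]

theorem inner_comp (z : B) (h h' : H) : inner ℂ h ((D.comp z : H →L[ℂ] H) h') =
    inner ℂ (D.V h) ((z : K →L[ℂ] K) (D.V h')) := by
  rw [comp_apply, ContinuousLinearMap.adjoint_inner_right]; rfl

theorem cor_mul_mul_cor (z : B) (x y : A) :
    D.cor x * z * D.cor y = D.cor (x * D.comp z * y) := by
  refine Subtype.ext <| ContinuousLinearMap.ext fun k => ?_
  change (D.cor x : K →L[ℂ] K) ((z : K →L[ℂ] K) ((D.cor y : K →L[ℂ] K) k)) = _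
  simp only [cor_apply]
  rfl

theorem comp_mul_cor_mul (z w : B) : D.comp (z * D.cor 1 * w) = D.comp z * D.comp w := by
  refine Subtype.ext <| ContinuousLinearMap.ext fun h => ?_
  rfl

theorem star_cor (x : A) : star (D.cor x) = D.cor (star x) := by
  refine Subtype.ext ?_
  change ContinuousLinearMap.adjoint (corner D.V x) = corner D.V (star (x : H →L[ℂ] H))
  simp only [corner, ContinuousLinearMap.adjoint_comp, ContinuousLinearMap.adjoint_adjoint]
  rfl

theorem norm_adjoint_V_le (k : K) :
    ‖ContinuousLinearMap.adjoint D.V.toContinuousLinearMap k‖ ≤ ‖k‖ := by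
  refine (ContinuousLinearMap.le_opNorm _ _).trans ?_
  rw [LinearIsometryEquiv.norm_map]
  exact mul_le_of_le_one_left (norm_nonneg _) D.V.norm_toContinuousLinearMap_le

theorem norm_comp_le (z : B) : ‖D.comp z‖ ≤ ‖z‖ := by
  refine ContinuousLinearMap.opNorm_le_bound _ (norm_nonneg z) fun h => ?_
  have h1 := (z : K →L[ℂ] K).le_opNorm (D.V h)
  rw [D.V.norm_map] at h1
  exact (D.norm_adjoint_V_le _).trans h1

theorem norm_cor_le (x : A) : ‖D.cor x‖ ≤ ‖x‖ := by
  refine ContinuousLinearMap.opNorm_le_bound _ (norm_nonneg x) fun k => ?_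
  change ‖D.V ((x : H →L[ℂ] H) (ContinuousLinearMap.adjoint D.V.toContinuousLinearMap k))‖ ≤ _
  rw [D.V.norm_map]
  exact ((x : H →L[ℂ] H).le_opNorm _).trans
    (mul_le_mul_of_nonneg_left (D.norm_adjoint_V_le k) (norm_nonneg _))

/-- The powers of the endomorphism of a dilation. -/
noncomputable def pow : ℕ → B →⋆ₙₐ[ℂ] B
  | 0 => NonUnitalStarAlgHom.id ℂ B
  | n + 1 => D.θ.comp (pow n)

@[simp] theorem pow_zero_apply (z : B) : D.pow 0 z = z := rfl

theorem pow_succ_apply (n : ℕ) (z : B) : D.pow (n + 1) z = D.θ (D.pow n z) := rfl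

theorem pow_one_apply (z : B) : D.pow 1 z = D.θ z := rfl

theorem iterate_eq_pow (n : ℕ) (z : B) : D.θ^[n] z = D.pow n z := by
  induction n with
  | zero => rfl
  | succ n ih => rw [Function.iterate_succ_apply', ih, pow_succ_apply]

theorem pow_add_apply (m n : ℕ) (z : B) : D.pow (m + n) z = D.pow m (D.pow n z) := by
  rw [← iterate_eq_pow, ← iterate_eq_pow, ← iterate_eq_pow, Function.iterate_add_apply]

theorem endo_pow_apply (n : ℕ) (z : B) : (D.endo ^ n) z = D.pow n z := by
  rw [Module.End.pow_apply, ← iterate_eq_pow]; rfl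

theorem norm_endo_le (z : B) : ‖D.endo z‖ ≤ ‖z‖ := NonUnitalStarAlgHom.norm_apply_le D.θ z

theorem norm_pow_le (n : ℕ) (z : B) : ‖D.pow n z‖ ≤ ‖z‖ := NonUnitalStarAlgHom.norm_apply_le _ z

theorem comp_pow (n : ℕ) (z : B) : D.comp (D.pow n z) = (T ^ n) (D.comp z) := by
  rw [Module.End.pow_apply, ← iterate_eq_pow]
  exact Subtype.ext (D.dilates n z)

/-- The vectors `θⁿ(xₙ) ⋯ θ(x₁) h` with `xᵢ ∈ A`. -/
noncomputable def dv (l : List A) (h : H) : K := dilationVector D.θ D.V (l.map D.cor) h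

theorem dv_nil (h : H) : D.dv [] h = D.V h := rfl

theorem dv_cons (a : A) (l : List A) (h : H) :
    D.dv (a :: l) h = (D.pow (l.length + 1) (D.cor a) : K →L[ℂ] K) (D.dv l h) := by
  rw [← iterate_eq_pow, dv, List.map_cons, dilationVector, List.length_map]
  rfl

end MinimalDilation
end Dilation

/-! ### Matrix coefficients on generating vectors and the lift to `P(θ)`. -/

section Dilation

variable {H : Type*} [NormedAddCommGroup H] [InnerProductSpace ℂ H] [CompleteSpace H]
  {K : Type*} [NormedAddCommGroup K] [InnerProductSpace ℂ K] [CompleteSpace K]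
  {A : VonNeumannAlgebra H} {T : A →ₗ[ℂ] A} {B : VonNeumannAlgebra K}

namespace MinimalDilation

variable (D : MinimalDilation T B)

theorem inner_star_apply (z : B) (k k' : K) :
    inner ℂ (((star z : B) : K →L[ℂ] K) k) k' = inner ℂ k ((z : K →L[ℂ] K) k') :=
  ContinuousLinearMap.adjoint_inner_left _ _ _

theorem dense_dv : Dense (Submodule.span ℂ {k : K | ∃ l h, k = D.dv l h} : Set K) :=
  Submodule.dense_iff_topologicalClosure_eq_top.2 D.minimal

theorem ext_dv {z w : B} (h : ∀ l h l' h', inner ℂ (D.dv l h) ((z : K →L[ℂ] K) (D.dv l' h')) =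
    inner ℂ (D.dv l h) ((w : K →L[ℂ] K) (D.dv l' h'))) : z = w := by
  refine Subtype.ext (ContinuousLinearMap.ext_on D.dense_dv ?_)
  rintro _ ⟨l', h', rfl⟩
  refine D.dense_dv.eq_of_inner_right (𝕜 := ℂ) fun v hv => ?_
  induction hv using Submodule.span_induction with
  | mem v hv => obtain ⟨l, g, rfl⟩ := hv; exact h l g l' h'
  | zero => simp
  | add x y _ _ hx hy => rw [inner_add_left, inner_add_left, hx, hy]
  | smul c x _ hx => rw [inner_smul_left, inner_smul_left, hx]

/-- If `w` vanishes on `H` then so does `θⁿ(w)`. -/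
theorem pow_apply_V_eq_zero {w : B} (hw : ∀ h, (w : K →L[ℂ] K) (D.V h) = 0) (n : ℕ) (h : H) :
    (D.pow n w : K →L[ℂ] K) (D.V h) = 0 := by
  -- `‖θⁿ(w) h‖²` is the form of `Tⁿ` applied to the compression of `w* w`, which is zero.
  have h1 : D.comp (star w * w) = 0 := Subtype.ext <| ContinuousLinearMap.ext fun g => by
    rw [comp_apply]
    change ContinuousLinearMap.adjoint _ (((star w : B) : K →L[ℂ] K) ((w : K →L[ℂ] K) (D.V g))) = 0
    rw [hw, map_zero, map_zero]
  have h2 := D.inner_comp (D.pow n (star w * w)) h h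
  rw [comp_pow, h1, map_zero, map_mul, map_star] at h2
  rw [← inner_self_eq_zero (𝕜 := ℂ), ← inner_star_apply, ← inner_conj_symm]
  change (starRingEnd ℂ) (inner ℂ (D.V h) _) = 0
  rw [map_eq_zero]
  refine h2.symm.trans ?_
  simp

theorem pow_apply_dv_eq_zero {w : B} (hw : ∀ h, (w : K →L[ℂ] K) (D.V h) = 0) {n : ℕ}
    {l : List A} (hl : l.length ≤ n) (h : H) : (D.pow n w : K →L[ℂ] K) (D.dv l h) = 0 := by
  cases l with
  | nil => exact D.pow_apply_V_eq_zero hw n h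
  | cons a l =>
    rw [List.length_cons] at hl
    obtain ⟨m, rfl⟩ := Nat.exists_eq_add_of_le hl
    -- The range of `a` lies in `H`, where `θᵐ(w)` vanishes; applying the power `|l| + 1` of `θ` to
    -- the product removes the leading factor of the vector.
    have h1 : D.pow m w * D.cor a = 0 := Subtype.ext <| ContinuousLinearMap.ext fun k => by
      change (D.pow m w : K →L[ℂ] K) ((D.cor a : K →L[ℂ] K) k) = 0
      rw [cor_apply, D.pow_apply_V_eq_zero hw]
    rw [dv_cons, pow_add_apply]
    change ((D.pow (l.length + 1) (D.pow m w) * D.pow (l.length + 1) (D.cor a) : B) : K →L[ℂ] K) _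
      = 0
    rw [← map_mul, h1, map_zero]
    rfl

theorem pow_apply_dv_eq (z : B) {n : ℕ} {l : List A} (hl : l.length ≤ n) (h : H) :
    (D.pow n z : K →L[ℂ] K) (D.dv l h) = (D.pow n (z * D.cor 1) : K →L[ℂ] K) (D.dv l h) := by
  have h1 := D.pow_apply_dv_eq_zero (w := z - z * D.cor 1) (fun g => by
    change (z : K →L[ℂ] K) (D.V g) - (z : K →L[ℂ] K) ((D.cor 1 : K →L[ℂ] K) (D.V g)) = 0
    rw [cor_apply_V]
    exact sub_self _) hl h
  rw [map_sub] at h1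
  exact sub_eq_zero.1 h1

/-- The matrix coefficients of `θⁿ(z)` between vectors of length at most `n` depend only on the
compression of `z`. -/
theorem inner_dv_pow (z : B) {n : ℕ} {l l' : List A} (hl : l.length ≤ n) (hl' : l'.length ≤ n)
    (h h' : H) : inner ℂ (D.dv l h) ((D.pow n z : K →L[ℂ] K) (D.dv l' h')) =
    inner ℂ (D.dv l h) ((D.pow n (D.cor (D.comp z)) : K →L[ℂ] K) (D.dv l' h')) := by
  have h1 : D.cor (D.comp z) = D.cor 1 * z * D.cor 1 := by
    rw [cor_mul_mul_cor, one_mul, mul_one]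
  -- The right-hand vector absorbs one factor `p`; after passing to the adjoint the left-hand vector
  -- absorbs another, leaving `p z p`.
  have h2 : star (star (z * D.cor 1) * D.cor 1) = D.cor (D.comp z) := by
    rw [h1, star_mul, star_star, star_cor, star_one, mul_assoc]
  rw [D.pow_apply_dv_eq z hl', ← inner_star_apply, ← map_star, D.pow_apply_dv_eq _ hl,
    ← h2, map_star (D.pow n) (star (z * D.cor 1) * D.cor 1), ← inner_star_apply, star_star]

/-- Vectors of positive length are images of vectors of smaller length under `θ`. -/
theorem exists_eq_map_apply_V (a : A) (l : List A) : ∃ (s : B) (l₀ : List A) (c : A),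
    l₀.length = l.length ∧ (∀ g, (s : K →L[ℂ] K) (D.V g) = D.dv l₀ ((c : H →L[ℂ] H) g)) ∧
      ∀ h, D.dv (a :: l) h = (D.θ s : K →L[ℂ] K) (D.V h) := by
  induction l generalizing a with
  | nil => exact ⟨D.cor a, [], a, rfl, fun g => D.cor_apply_V a g, fun h => D.dv_cons a [] h⟩
  | cons b l ih =>
    obtain ⟨s, l₀, c, h1, h2, h3⟩ := ih b
    refine ⟨D.pow (l.length + 1) (D.cor a) * s, a :: l₀, c, by simp [h1], fun g => ?_, fun h => ?_⟩
    · rw [dv_cons, h1, ← h2]; rfl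
    · rw [dv_cons, h3, map_mul, ← pow_succ_apply, List.length_cons]; rfl

/-- Lets `θ(z)` act on a generating vector as `θ(z s)` on `H`, where `s` sends `H` to vectors that
are no longer. Coefficients of `θ(z)` then become values of `T` on compressions `s* z s'`. -/
theorem exists_map_apply_dv (l : List A) : ∃ (s : B) (l₀ : List A) (c : A),
    l₀.length ≤ l.length ∧ (∀ g, (s : K →L[ℂ] K) (D.V g) = D.dv l₀ ((c : H →L[ℂ] H) g)) ∧
      ∀ (z : B) (h : H), (D.θ z : K →L[ℂ] K) (D.dv l h) = (D.θ (z * s) : K →L[ℂ] K) (D.V h) := by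
  cases l with
  | nil => exact ⟨1, [], 1, le_rfl, fun g => rfl, fun z h => by rw [mul_one]; rfl⟩
  | cons a l =>
    obtain ⟨s, l₀, c, h1, h2, h3⟩ := D.exists_eq_map_apply_V a l
    refine ⟨s, l₀, c, by simp [h1], h2, fun z h => ?_⟩
    rw [h3, map_mul]; rfl

/-- The matrix coefficients of `θ(z)` between vectors of length at most `n` are determined by those
of `z`. -/
theorem inner_dv_map_congr {n : ℕ} {z w : B}
    (hzw : ∀ l h l' h', l.length ≤ n → l'.length ≤ n →
      inner ℂ (D.dv l h) ((z : K →L[ℂ] K) (D.dv l' h')) =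
      inner ℂ (D.dv l h) ((w : K →L[ℂ] K) (D.dv l' h')))
    {l l' : List A} (hl : l.length ≤ n) (hl' : l'.length ≤ n) (h h' : H) :
    inner ℂ (D.dv l h) ((D.θ z : K →L[ℂ] K) (D.dv l' h')) =
      inner ℂ (D.dv l h) ((D.θ w : K →L[ℂ] K) (D.dv l' h')) := by
  obtain ⟨s, l₀, c, h1, h2, h3⟩ := D.exists_map_apply_dv l
  obtain ⟨s', l₀', c', h1', h2', h3'⟩ := D.exists_map_apply_dv l'
  have key : ∀ y : B, inner ℂ (D.dv l h) ((D.θ y : K →L[ℂ] K) (D.dv l' h')) =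
      inner ℂ h ((T (D.comp (star s * y * s')) : H →L[ℂ] H) h') := by
    intro y
    have h4 : star (y * s') * s = star (star s * (y * s')) := by rw [star_mul (star s), star_star]
    have h5 := D.comp_pow 1 (star s * (y * s'))
    rw [pow_one, pow_one_apply] at h5
    rw [h3', ← inner_star_apply, ← map_star, h3, h4, map_star, inner_star_apply, ← inner_comp, h5,
      mul_assoc]
  have hcomp : D.comp (star s * z * s') = D.comp (star s * w * s') := by
    refine Subtype.ext <| ContinuousLinearMap.ext fun g' => ext_inner_left ℂ fun g => ?_
    have h4 : ∀ y : B, inner ℂ g ((D.comp (star s * y * s') : H →L[ℂ] H) g') =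
        inner ℂ (D.dv l₀ ((c : H →L[ℂ] H) g))
          ((y : K →L[ℂ] K) (D.dv l₀' ((c' : H →L[ℂ] H) g'))) := by
      intro y
      rw [inner_comp, ← h2, ← h2']
      have h5 := inner_star_apply (star s) (D.V g)
        ((y : K →L[ℂ] K) ((s' : K →L[ℂ] K) (D.V g')))
      rw [star_star] at h5
      exact h5.symm
    rw [h4, h4]
    exact hzw _ _ _ _ (h1.trans hl) (h1'.trans hl')
  rw [key, key, hcomp]

variable (hT : ∀ x : A, ‖T x‖ ≤ ‖x‖)

/-- `X` is the weak limit of `θⁿ(σⁿ(x))`, with `σ` the inverse of `T` on `P(T)`: its matrix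
coefficients between vectors of length at most `n` are those of `θⁿ(σⁿ(x))`. -/
def IsLift (x : boundary T) (X : B) : Prop :=
  ∀ (n : ℕ) (l : List A) (h : H) (l' : List A) (h' : H), l.length ≤ n → l'.length ≤ n →
    inner ℂ (D.dv l h) ((X : K →L[ℂ] K) (D.dv l' h')) =
      inner ℂ (D.dv l h) ((D.pow n (D.cor (back hT n x)) : K →L[ℂ] K) (D.dv l' h'))

/-- For `m = n + k`, the element `θᵏ(σᵐ(x))` compresses to `Tᵏ(σᵐ(x)) = σⁿ(x)`, so coefficients
between vectors of length at most `n` no longer change after step `n`. The ultrafilter limit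
supplies an operator in `B` with these coefficients and the norm bound. -/
theorem exists_isLift (x : boundary T) : ∃ X : B, ‖X‖ ≤ ‖x‖ ∧ D.IsLift hT x X := by
  obtain ⟨X, h1, h2⟩ := exists_tendsto_inner_ultrafilter (hyperfilter ℕ)
    (z := fun n => D.pow n (D.cor (back hT n x))) (C := ‖x‖) (fun n => by
      rw [← norm_back hT n x]
      exact (D.norm_pow_le n _).trans (D.norm_cor_le _))
  refine ⟨X, h1, fun n l h l' h' hl hl' => ?_⟩
  refine tendsto_nhds_unique (h2 _ _) (tendsto_const_nhds.congr' ?_)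
  refine Nat.hyperfilter_le_atTop ?_
  filter_upwards [eventually_ge_atTop n] with m hm
  obtain ⟨k, rfl⟩ := Nat.exists_eq_add_of_le hm
  rw [pow_add_apply, D.inner_dv_pow (D.pow k _) hl hl', comp_pow, comp_cor, add_comm n k, pow_back]

theorem IsLift.unique {D : MinimalDilation T B} {hT : ∀ x : A, ‖T x‖ ≤ ‖x‖} {x : boundary T}
    {X Y : B} (hX : D.IsLift hT x X) (hY : D.IsLift hT x Y) : X = Y :=
  D.ext_dv fun l h l' h' => by
    rw [hX (max l.length l'.length) l h l' h' (le_max_left _ _) (le_max_right _ _),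
      hY (max l.length l'.length) l h l' h' (le_max_left _ _) (le_max_right _ _)]

theorem IsLift.add {D : MinimalDilation T B} {hT : ∀ x : A, ‖T x‖ ≤ ‖x‖} {x y : boundary T}
    {X Y : B} (hX : D.IsLift hT x X) (hY : D.IsLift hT y Y) : D.IsLift hT (x + y) (X + Y) := by
  intro n l h l' h' hl hl'
  have h1 : D.pow n (D.cor (back hT n (x + y))) =
      D.pow n (D.cor (back hT n x)) + D.pow n (D.cor (back hT n y)) := by
    rw [map_add, Submodule.coe_add, map_add, map_add]
  rw [h1]
  change inner ℂ _ ((X : K →L[ℂ] K) _ + (Y : K →L[ℂ] K) _) = inner ℂ _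
    ((D.pow n (D.cor (back hT n x)) : K →L[ℂ] K) _ + (D.pow n (D.cor (back hT n y)) : K →L[ℂ] K) _)
  rw [inner_add_right, inner_add_right, hX n l h l' h' hl hl', hY n l h l' h' hl hl']

theorem IsLift.smul {D : MinimalDilation T B} {hT : ∀ x : A, ‖T x‖ ≤ ‖x‖} {x : boundary T}
    {X : B} (c : ℂ) (hX : D.IsLift hT x X) : D.IsLift hT (c • x) (c • X) := by
  intro n l h l' h' hl hl'
  have h1 : D.pow n (D.cor (back hT n (c • x))) = c • D.pow n (D.cor (back hT n x)) := by
    rw [map_smul, Submodule.coe_smul, map_smul, map_smul]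
  rw [h1]
  change inner ℂ _ (c • (X : K →L[ℂ] K) _) = inner ℂ _
    (c • (D.pow n (D.cor (back hT n x)) : K →L[ℂ] K) _)
  rw [inner_smul_right, inner_smul_right, hX n l h l' h' hl hl']

theorem IsLift.comp_eq {D : MinimalDilation T B} {hT : ∀ x : A, ‖T x‖ ≤ ‖x‖} {x : boundary T}
    {X : B} (hX : D.IsLift hT x X) : D.comp X = x := by
  refine Subtype.ext <| ContinuousLinearMap.ext fun g' => ext_inner_left ℂ fun g => ?_
  rw [inner_comp, ← dv_nil, ← dv_nil, hX 0 [] g [] g' le_rfl le_rfl, dv_nil, dv_nil, ← inner_comp,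
    pow_zero_apply, comp_cor, back_zero]

theorem IsLift.mem_eigenspace {D : MinimalDilation T B} {hT : ∀ x : A, ‖T x‖ ≤ ‖x‖}
    {x : boundary T} {X : B} (hX : D.IsLift hT x X) {lam : Circle}
    (hx : (x : A) ∈ eigenspace T lam) : X ∈ eigenspace D.endo lam := by
  rw [mem_eigenspace_iff]
  refine D.ext_dv fun l h l' h' => ?_
  set n := max l.length l'.length
  -- `X` is only a weak limit, but on vectors of bounded length it may be replaced under `θ` by one
  -- term of the sequence.
  have h1 := D.inner_dv_map_congr (n := n) (z := X) (w := D.pow n (D.cor (back hT n x)))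
    (fun l h l' h' hl hl' => hX n l h l' h' hl hl') (le_max_left l.length l'.length)
    (le_max_right l.length l'.length) h h'
  refine h1.trans ?_
  -- Going from index `n` to `n + 1` introduces a factor `λ⁻¹`, compensated by the eigenvalue.
  have h2 : D.θ (D.pow n (D.cor (back hT n x))) =
      (lam : ℂ) • D.pow (n + 1) (D.cor (back hT (n + 1) x)) := by
    rw [← pow_succ_apply, back_of_mem_eigenspace hT hx, back_of_mem_eigenspace hT hx,
      Submodule.coe_smul, Submodule.coe_smul, map_smul, map_smul, map_smul, map_smul, smul_smul]
    congr 1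
    have := lam.coe_ne_zero
    field_simp
    ring
  rw [h2]
  change inner ℂ _ ((lam : ℂ) • (D.pow (n + 1) (D.cor (back hT (n + 1) x)) : K →L[ℂ] K) _) =
    inner ℂ _ ((lam : ℂ) • (X : K →L[ℂ] K) _)
  rw [inner_smul_right, inner_smul_right, hX (n + 1) l h l' h'
    ((le_max_left _ _).trans (Nat.le_succ _)) ((le_max_right _ _).trans (Nat.le_succ _))]

/-- The lift `x ↦ x̂`. -/
noncomputable def lift : boundary T →L[ℂ] B :=
  LinearMap.mkContinuous
    { toFun := fun x => (D.exists_isLift hT x).choose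
      map_add' := fun x y => (D.exists_isLift hT (x + y)).choose_spec.2.unique
        ((D.exists_isLift hT x).choose_spec.2.add (D.exists_isLift hT y).choose_spec.2)
      map_smul' := fun c x => (D.exists_isLift hT (c • x)).choose_spec.2.unique
        ((D.exists_isLift hT x).choose_spec.2.smul c) } 1
    fun x => by
      rw [one_mul]
      exact (D.exists_isLift hT x).choose_spec.1

theorem isLift_lift (x : boundary T) : D.IsLift hT x (D.lift hT x) :=
  (D.exists_isLift hT x).choose_spec.2

theorem lift_mem_boundary (x : boundary T) : D.lift hT x ∈ boundary D.endo :=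
  map_mem_of_eigenvectors (D.lift hT) (boundary D.endo) (Submodule.isClosed_topologicalClosure _)
    (fun _ x hx => mem_boundary_of_mem_eigenspace ((D.isLift_lift hT x).mem_eigenspace hx)) x

theorem comp_lift (x : boundary T) : D.comp (D.lift hT x) = x := (D.isLift_lift hT x).comp_eq

/-- The compression as a bounded map. -/
noncomputable def compL : B →L[ℂ] A :=
  D.comp.mkContinuous 1 fun z => by simpa using D.norm_comp_le z

theorem comp_mem_eigenspace {lam : Circle} {z : B} (hz : z ∈ eigenspace D.endo lam) :
    D.comp z ∈ eigenspace T lam := by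
  rw [mem_eigenspace_iff] at hz ⊢
  have h1 := D.comp_pow 1 z
  rw [pow_one] at h1
  rw [← h1, ← map_smul, ← hz]
  rfl

theorem comp_mem_boundary (z : boundary D.endo) : D.comp z ∈ boundary T :=
  map_mem_of_eigenvectors (D.compL.comp (boundary D.endo).subtypeL) (boundary T)
    (Submodule.isClosed_topologicalClosure _)
    (fun _ _ hz => mem_boundary_of_mem_eigenspace (D.comp_mem_eigenspace hz)) z

/-- The compression `P(θ) → P(T)`. -/
noncomputable def boundaryComp : boundary D.endo →L[ℂ] boundary T :=
  (D.compL.comp (boundary D.endo).subtypeL).codRestrict (boundary T) D.comp_mem_boundary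

theorem coe_boundaryComp (z : boundary D.endo) : (D.boundaryComp z : A) = D.comp z := rfl

include hT in
/-- The compression is injective on `P(θ)`. -/
theorem eq_zero_of_comp_eq_zero {z : boundary D.endo} (hz : D.comp z = 0) : z = 0 := by
  refine Subtype.ext (D.ext_dv fun l h l' h' => ?_)
  set n := max l.length l'.length
  set y := back D.norm_endo_le n z
  have h1 : D.pow n y = z := by
    rw [← endo_pow_apply]; exact pow_back_self D.norm_endo_le n z
  -- The compression of `y` lies in `P(T)`, where `Tⁿ` is injective, and `Tⁿ` sends it to the
  -- compression of `z`.
  have h2 : D.comp y = 0 := by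
    have h3 : (T ^ n) (D.boundaryComp y) = ((0 : boundary T) : A) := by
      rw [coe_boundaryComp, ← comp_pow, h1, hz]; rfl
    have h4 := back_eq_of_pow hT h3
    rw [map_zero] at h4
    exact congrArg Subtype.val h4.symm
  rw [← h1, D.inner_dv_pow _ (le_max_left l.length l'.length) (le_max_right l.length l'.length),
    h2, map_zero, map_zero]
  rfl

end MinimalDilation
end Dilation

/-! ### The Choi–Effros product as a compressed product. -/

section Dilation

variable {H : Type*} [NormedAddCommGroup H] [InnerProductSpace ℂ H] [CompleteSpace H]
  {K : Type*} [NormedAddCommGroup K] [InnerProductSpace ℂ K] [CompleteSpace K]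
  {A : VonNeumannAlgebra H} {T : A →ₗ[ℂ] A} {B : VonNeumannAlgebra K}

namespace MinimalDilation

variable (D : MinimalDilation T B)

/-- The projections `θⁿ(1)` and `θⁿ(p)` are asymptotically equal. -/
theorem tendsto_pow_one_sub_cor (k : K) :
    Tendsto (fun n => (D.pow n (1 - D.cor 1) : K →L[ℂ] K) k) atTop (𝓝 0) := by
  have hcl := isClosed_tendsto_zero (E := fun n => (D.pow n (1 - D.cor 1) : K →L[ℂ] K))
    (C := ‖(1 - D.cor 1 : B)‖) (fun n => D.norm_pow_le n _)
  refine closure_minimal (fun v hv => ?_) hcl (D.dense_dv k)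
  induction hv using Submodule.span_induction with
  | mem v hv =>
    obtain ⟨l, h, rfl⟩ := hv
    refine tendsto_const_nhds.congr' ?_
    filter_upwards [eventually_ge_atTop l.length] with n hn
    refine (D.pow_apply_dv_eq_zero (fun g => ?_) hn h).symm
    change D.V g - (D.cor 1 : K →L[ℂ] K) (D.V g) = 0
    rw [cor_apply_V]
    exact sub_self _
  | zero => simp
  | add x y _ _ hx hy => simpa only [Set.mem_ofPred_eq, map_add, add_zero] using Tendsto.add hx hy
  | smul c x _ hx => simpa only [Set.mem_ofPred_eq, map_smul, smul_zero] using Tendsto.const_smul hx c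

theorem pow_eq_of_mem_eigenspace {lam : Circle} {z : B} (hz : z ∈ eigenspace D.endo lam) (n : ℕ) :
    D.pow n z = (lam : ℂ) ^ n • z := by
  rw [← endo_pow_apply, pow_apply_of_mem_eigenspace hz]

/-- The product of compressed eigenvectors. -/
theorem sotTendsto_comp_mul {lam mu : Circle} {z w : B} (hz : z ∈ eigenspace D.endo lam)
    (hw : w ∈ eigenspace D.endo mu) :
    SOTTendsto (fun n => ((lam : ℂ) ^ n * (mu : ℂ) ^ n)⁻¹ • (T ^ n) (D.comp z * D.comp w))
      (D.comp (z * w)) := by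
  -- Insert `θⁿ(p)` between `z` and `w`: up to scalars `z θⁿ(p) w` is `θⁿ(z p w)`, whose compression
  -- is `Tⁿ` of the product of compressions.
  have h1 : ∀ n, ((lam : ℂ) ^ n * (mu : ℂ) ^ n)⁻¹ • (T ^ n) (D.comp z * D.comp w) =
      D.comp (z * w) - D.comp (z * D.pow n (1 - D.cor 1) * w) := by
    intro n
    have hl := pow_ne_zero n lam.coe_ne_zero
    have hm := pow_ne_zero n mu.coe_ne_zero
    have h2 : z * D.pow n 1 * w = z * w := by
      -- `θ` need not be unital, but `θⁿ(1)` fixes `θⁿ(w)`, a nonzero multiple of `w`.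
      have h3 : D.pow n 1 * w = w := by
        have h4 := map_mul (D.pow n) 1 w
        rw [one_mul, D.pow_eq_of_mem_eigenspace hw, mul_smul_comm] at h4
        exact ((smul_right_injective _ hm) h4).symm
      rw [mul_assoc, h3]
    rw [← map_sub, map_sub (D.pow n), mul_sub, sub_mul, h2, sub_sub_cancel, ← comp_mul_cor_mul,
      ← comp_pow, map_mul (D.pow n), map_mul (D.pow n), D.pow_eq_of_mem_eigenspace hz, D.pow_eq_of_mem_eigenspace hw,
      smul_mul_assoc, smul_mul_assoc, mul_smul_comm, smul_smul, map_smul, smul_smul,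
      inv_mul_cancel₀ (mul_ne_zero hl hm), one_smul]
  simp only [h1]
  intro h
  have h2 := D.tendsto_pow_one_sub_cor ((w : K →L[ℂ] K) (D.V h))
  have h4 : Tendsto (fun n => (D.comp (z * D.pow n (1 - D.cor 1) * w) : H →L[ℂ] H) h) atTop
      (𝓝 0) := by
    have h5 := ((ContinuousLinearMap.adjoint D.V.toContinuousLinearMap).comp
      (z : K →L[ℂ] K)).continuous.tendsto 0
    rw [map_zero] at h5
    exact h5.comp h2
  simpa using (tendsto_const_nhds (x := (D.comp (z * w) : H →L[ℂ] H) h)).sub h4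

/-- Both sides are continuous and bilinear, so one variable at a time reduces to eigenvectors of
`θ`, where both are the same strong limit. -/
theorem prod_boundaryComp (hT : IsNormalSchwarz T) (z w : boundary D.endo) :
    (hT.prod (D.boundaryComp z) (D.boundaryComp w) : A) = D.comp ((z : B) * (w : B)) := by
  have h1 : ∀ (lam : Circle) (z : boundary D.endo), (z : B) ∈ eigenspace D.endo lam →
      ∀ w : boundary D.endo,
        (hT.prod (D.boundaryComp z) (D.boundaryComp w) : A) = D.comp ((z : B) * (w : B)) := by
    intro lam z hz w
    refine DFunLike.congr_fun (eq_of_eigenvectors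
      (f := (boundary T).subtypeL.comp ((hT.prod (D.boundaryComp z)).comp D.boundaryComp))
      (g := D.compL.comp ((ContinuousLinearMap.mul ℂ B (z : B)).comp (boundary D.endo).subtypeL))
      fun mu w hw => ?_) w
    refine (hT.isChoiEffrosProduct_prod lam mu (D.boundaryComp z) (D.boundaryComp w)
      (D.comp_mem_eigenspace hz) (D.comp_mem_eigenspace hw)).unique ?_
    simp only [← Module.End.pow_apply]
    exact D.sotTendsto_comp_mul hz hw
  exact DFunLike.congr_fun (eq_of_eigenvectors
    (f := (boundary T).subtypeL.comp ((hT.prod.flip (D.boundaryComp w)).comp D.boundaryComp))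
    (g := D.compL.comp (((ContinuousLinearMap.mul ℂ B).flip (w : B)).comp
      (boundary D.endo).subtypeL))
    fun lam z hz => h1 lam z hz w) z

theorem isCompressedProduct (hT : IsNormalSchwarz T) : D.IsCompressedProduct hT.prod := by
  refine ⟨fun x => ⟨D.lift hT.norm_map_le x, ⟨D.lift_mem_boundary hT.norm_map_le x,
    congrArg Subtype.val (D.comp_lift hT.norm_map_le x)⟩, ?_⟩, ?_⟩
  · rintro z ⟨hz, hzx⟩
    let u : boundary D.endo := ⟨z, hz⟩
    let v : boundary D.endo := ⟨D.lift hT.norm_map_le x, D.lift_mem_boundary hT.norm_map_le x⟩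
    have h1 : D.comp ((u - v : boundary D.endo) : B) = 0 := by
      rw [AddSubgroupClass.coe_sub, map_sub, sub_eq_zero]
      exact (Subtype.ext hzx).trans (D.comp_lift hT.norm_map_le x).symm
    exact congrArg Subtype.val (sub_eq_zero.1 (D.eq_zero_of_comp_eq_zero hT.norm_map_le h1))
  · intro x y z w hz hw hzx hwy
    have hx : D.boundaryComp ⟨z, hz⟩ = x := Subtype.ext (Subtype.ext hzx)
    have hy : D.boundaryComp ⟨w, hw⟩ = y := Subtype.ext (Subtype.ext hwy)
    have h1 := D.prod_boundaryComp hT ⟨z, hz⟩ ⟨w, hw⟩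
    rw [hx, hy] at h1
    exact congrArg Subtype.val h1

end MinimalDilation
end Dilation

/-! ### The main theorem. -/

theorem isNormalSchwarz {H : Type*} [NormedAddCommGroup H] [InnerProductSpace ℂ H]
    [CompleteSpace H] {A : VonNeumannAlgebra H} (τ : A →CP A)
    (hcontractive : ∀ x : A, ‖τ x‖ ≤ ‖x‖) (hnormal : ScottContinuous τ) :
    IsNormalSchwarz τ.toLinearMap where
  norm_map_le := hcontractive
  monotone := OrderHomClass.mono τ
  map_star := map_star τ
  schwarz := star_map_mul_map_le hcontractive
  normal := hnormal

end PeripheralPoisson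

theorem mainTheorem1 {H : Type*} [NormedAddCommGroup H] [InnerProductSpace ℂ H]
    [CompleteSpace H] (A : VonNeumannAlgebra H) (τ : A →CP A)
    (hcontractive : ∀ x : A, ‖τ x‖ ≤ ‖x‖) (hnormal : ScottContinuous τ) :
    ∃ (q : A) (m : PeripheralPoisson.boundary τ.toLinearMap →L[ℂ]
        PeripheralPoisson.boundary τ.toLinearMap →L[ℂ]
        PeripheralPoisson.boundary τ.toLinearMap),
      -- `q` is the strong limit of `τⁿ(1)`
      PeripheralPoisson.SOTTendsto (fun n => τ^[n] 1) q ∧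
      -- `m` is the extended Choi–Effros product, and it makes `P(τ)` a C*-algebra
      PeripheralPoisson.IsChoiEffrosProduct τ.toLinearMap m ∧
      (∀ m', PeripheralPoisson.IsChoiEffrosProduct τ.toLinearMap m' → m' = m) ∧
      (∀ (K : Type*) [NormedAddCommGroup K] [InnerProductSpace ℂ K] [CompleteSpace K]
        (B : VonNeumannAlgebra K) (D : PeripheralPoisson.MinimalDilation τ.toLinearMap B),
        D.IsCompressedProduct m) ∧
      PeripheralPoisson.IsCStarAlgebra (PeripheralPoisson.boundary τ.toLinearMap) m ∧
      -- the four equivalent conditions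
      List.TFAE [
        q ≠ 0,
        ∃ x : A, x ≠ 0 ∧ τ x = x,
        PeripheralPoisson.boundary τ.toLinearMap ≠ ⊥,
        ∃ e : PeripheralPoisson.boundary τ.toLinearMap,
          e ≠ 0 ∧ PeripheralPoisson.IsUnitFor m e] ∧
      -- the description of `q` when these conditions hold
      (q ≠ 0 →
        (∃ hq : q ∈ PeripheralPoisson.boundary τ.toLinearMap,
          PeripheralPoisson.IsUnitFor m ⟨q, hq⟩) ∧
        PeripheralPoisson.IsMaximalPerronFrobenius (PeripheralPoisson.contraction τ.toLinearMap hcontractive) q ∧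
        ∀ x : A, PeripheralPoisson.IsMaximalPerronFrobenius (PeripheralPoisson.contraction τ.toLinearMap hcontractive) x → x = q) := by
  have hT := PeripheralPoisson.isNormalSchwarz τ hcontractive hnormal
  obtain ⟨q, hq⟩ := hT.exists_polyTendsto_pow_one
  have hunit := hT.isUnitFor_limit_one hq
  have hqmem := PeripheralPoisson.IsNormalSchwarz.limit_one_mem hq
  -- `q` is always a unit for the product, so `q = 0` gives `x = 0 ∘ x = 0`.
  have hzero : q = 0 → ∀ x : PeripheralPoisson.boundary τ.toLinearMap, x = 0 := by
    intro h0 x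
    have h1 : (⟨q, hqmem⟩ : PeripheralPoisson.boundary τ.toLinearMap) = 0 := Subtype.ext h0
    have h2 := (hunit x).1
    have h3 := hT.norm_prod_le ⟨q, hqmem⟩ x
    rw [h2, h1, norm_zero, zero_mul] at h3
    exact norm_le_zero_iff.1 h3
  refine ⟨q, hT.prod, ?_, hT.isChoiEffrosProduct_prod,
    fun m' hm' => PeripheralPoisson.IsNormalSchwarz.eq_of_isChoiEffrosProduct hm'
      hT.isChoiEffrosProduct_prod,
    fun K _ _ _ B D => D.isCompressedProduct hT, hT.isCStarAlgebra, ?_, fun hq0 => ?_⟩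
  · have h1 := hq.sot
    simp only [Module.End.pow_apply] at h1
    exact h1
  · tfae_have 1 → 2 := fun h => ⟨q, h, PeripheralPoisson.IsNormalSchwarz.map_limit_one hq⟩
    tfae_have 2 → 3 := by
      rintro ⟨x, hx0, hx⟩ hbot
      have h1 : x ∈ PeripheralPoisson.boundary τ.toLinearMap :=
        PeripheralPoisson.mem_boundary_of_mem_eigenspace (lam := 1)
          (PeripheralPoisson.mem_eigenspace_iff.2 (by rw [Circle.coe_one, one_smul]; exact hx))
      rw [hbot] at h1
      exact hx0 ((Submodule.mem_bot ℂ).1 h1)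
    tfae_have 3 → 1 := by
      intro h h0
      exact h ((Submodule.eq_bot_iff _).2 fun x hx => congrArg Subtype.val (hzero h0 ⟨x, hx⟩))
    tfae_have 1 → 4 := fun h => ⟨⟨q, hqmem⟩, fun h0 => h (congrArg Subtype.val h0), hunit⟩
    tfae_have 4 → 1 := by
      rintro ⟨e, he, -⟩ h0
      exact he (hzero h0 e)
    tfae_finish
  · have hmax := hT.isMaximalPerronFrobenius_limit_one hq hq0
    exact ⟨⟨hqmem, hunit⟩, hmax, fun x hx => hx.unique hmax⟩
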